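/- Let $\mathcal{Q}_2$ be the universal unital $C^*$-algebra generated by a unitary $U$ and an isometry $S_2$ with $S_2U=U^2S_2$ and $S_2S_2^*+US_2S_2^*U^*=1$, and let $\mathcal{O}_2$ be the Cuntz algebra, i.e. the universal unital $C^*$-algebra generated by two isometries $S_1,S_2$ with $S_1S_1^*+S_2S_2^*=1$, included in $\mathcal{Q}_2$ through $S_1\mapsto US_2$, $S_2\mapsto S_2$. A pure state $\omega$ of $\mathcal{O}_2$ has the unique extension property if there is exactly one pure state $\Omega$ of $\mathcal{Q}_2$ whose restriction to $\mathcal{O}_2$ is $\omega$. An isometry $V$ on a Hilbert space is pure if $\bigcap_{n\ge1}\operatorname{Ran}(V^n)=0$. **Theorem.** Let $\pi:\mathcal{O}_2\to B(\mathcal{H})$ be an irreducible representation such that $\pi(S_1)$ and $\pi(S_2)$ are both pure. Then for every unit vector $x\in\mathcal{H}$ the vector state $\omega_x(T)=(\pi(T)x,x)$ is a pure state of $\mathcal{O}_2$ with the unique extension property with respect to $\mathcal{O}_2\subset\mathcal{Q}_2$. **Corollary.** Let $\pi:\mathcal{O}_2\to B(\mathcal{H})$ be an irreducible permutative representation of type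 $P(I)$, where $I$ is a finite or infinite multi-index in the alphabet $\{1,2\}$ with $|I|\ge2$ (so $I$ may be infinite). Then for every unit vector $x\in\mathcal{H}$ the vector state $\omega_x$ is a pure state of $\mathcal{O}_2$ with the unique extension property with respect to $\mathcal{O}_2\subset\mathcal{Q}_2$. Here $\pi$ is permutative if there are an orthonormal basis $(e_n)_{n\in\mathbb{N}}$ of $\mathcal{H}$ and injections $\sigma_1,\sigma_2:\mathbb{N}\to\mathbb{N}$ whose ranges are disjoint and cover $\mathbb{N}$, with $\pi(S_i)e_n=e_{\sigma_i(n)}$ for all $i,n$. It is of type $P(I)$ if, for some such basis, some basis vector $v$ is cyclic for $\pi$ and satisfies the following. If $I=(i_1,\dots,i_k)$ is finite: $\pi(S_{i_1}\cdots S_{i_k})v=v$ and the vectors $v,\ \pi(S_{i_1})v,\ \dots,\ \pi(S_{i_1}\cdots S_{i_{k-1}})v$ are orthonormal. If $I=(i_1,i_2,\dots)$ is infinite: the vectors $\pi(S_{i_1}\cdots S_{i_n})^*v$, $n\ge0$, are orthonormal. -/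

import Mathlib

open scoped ComplexOrder

noncomputable section

/-! ### The free unital `*`-algebra on a set of generators -/

/-- The free unital complex `*`-algebra on `X`: the monoid algebra of words in the letters
`(x, false)`, standing for `x`, and `(x, true)`, standing for the adjoint of `x`. -/
abbrev FreeStarAlg (X : Type) : Type := MonoidAlgebra ℂ (FreeMonoid (X × Bool))

namespace FreeStarAlg

variable {X : Type}

/-- The generator `x`. -/
def gen (x : X) : FreeStarAlg X := MonoidAlgebra.single (FreeMonoid.of (x, false)) 1

/-- The conjugate-linear ring homomorphism out of a monoid algebra extending `g`. -/
def conjLift {M B : Type*} [Monoid M] [Ring B] [Algebra ℂ B] (g : M →* B) :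
    MonoidAlgebra ℂ M →+* B :=
  MonoidAlgebra.liftNCRingHom ((algebraMap ℂ B).comp (starRingEnd ℂ)) g
    (fun c w => Algebra.commutes (starRingEnd ℂ c) (g w))

theorem conjLift_single {M B : Type*} [Monoid M] [Ring B] [Algebra ℂ B] (g : M →* B)
    (w : M) (c : ℂ) :
    conjLift g (MonoidAlgebra.single w c) = (starRingEnd ℂ c) • g w := by
  rw [Algebra.smul_def]
  exact MonoidAlgebra.liftNC_single _ _ _ _

/-- The conjugate-linear anti-endomorphism exchanging the letters `x` and `x*`. -/
def starHom : FreeStarAlg X →+* (FreeStarAlg X)ᵐᵒᵖ :=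
  conjLift (FreeMonoid.lift fun l : X × Bool =>
    MulOpposite.op (MonoidAlgebra.single (FreeMonoid.of (l.1, !l.2)) (1 : ℂ)))

theorem starHom_single (w : FreeMonoid (X × Bool)) (c : ℂ) :
    starHom (MonoidAlgebra.single w c) =
      (starRingEnd ℂ c) • FreeMonoid.lift (fun l : X × Bool =>
        MulOpposite.op (MonoidAlgebra.single (FreeMonoid.of (l.1, !l.2)) (1 : ℂ))) w :=
  conjLift_single _ _ _

theorem starHom_algebraMap (c : ℂ) :
    starHom (algebraMap ℂ (FreeStarAlg X) c) = algebraMap ℂ _ (starRingEnd ℂ c) := by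
  have : algebraMap ℂ (FreeStarAlg X) c = MonoidAlgebra.single 1 c := rfl
  rw [this, starHom_single, map_one, Algebra.algebraMap_eq_smul_one]

theorem starHom_smul (c : ℂ) (a : FreeStarAlg X) :
    starHom (c • a) = (starRingEnd ℂ c) • starHom a := by
  rw [Algebra.smul_def, map_mul, starHom_algebraMap, ← Algebra.smul_def]

theorem induction' {p : FreeStarAlg X → Prop} (h1 : p 1)
    (hl : ∀ l : X × Bool, p (MonoidAlgebra.single (FreeMonoid.of l) 1))
    (hm : ∀ a b, p a → p b → p (a * b)) (ha : ∀ a b, p a → p b → p (a + b))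
    (hs : ∀ (c : ℂ) a, p a → p (c • a)) (a : FreeStarAlg X) : p a := by
  refine MonoidAlgebra.induction_on a (fun w => ?_) ha (fun c a => hs c a)
  have hw : ∀ w : FreeMonoid (X × Bool), p (MonoidAlgebra.of ℂ _ w) := fun w => by
    induction w using FreeMonoid.inductionOn with
    | one => rw [map_one]; exact h1
    | of l => exact hl l
    | mul v w hv hw => rw [map_mul]; exact hm _ _ hv hw
  exact hw w

instance : StarRing (FreeStarAlg X) where
  star a := (starHom a).unop
  star_involutive a := by
    induction a using induction' with
    | h1 => simp
    | hl l => simp [starHom_single]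
    | hm a b ha hb => simp only [map_mul, MulOpposite.unop_mul, ha, hb]
    | ha a b ha hb => simp only [map_add, MulOpposite.unop_add, ha, hb]
    | hs c a ha => simp only [starHom_smul, MulOpposite.unop_smul, ha, Complex.conj_conj]
  star_mul a b := by simp
  star_add a b := by simp

theorem star_def (a : FreeStarAlg X) : star a = (starHom a).unop := rfl

instance : StarModule ℂ (FreeStarAlg X) where
  star_smul c a := by simp [star_def, starHom_smul]

theorem star_letter (l : X × Bool) :
    star (MonoidAlgebra.single (FreeMonoid.of l) (1 : ℂ) : FreeStarAlg X) =
      MonoidAlgebra.single (FreeMonoid.of (l.1, !l.2)) 1 := by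
  simp [star_def, starHom_single]

/-- Evaluation of the generators at elements of a unital `*`-algebra. -/
def eval {B : Type*} [Ring B] [StarRing B] [Algebra ℂ B] [StarModule ℂ B] (f : X → B) :
    FreeStarAlg X →⋆ₐ[ℂ] B :=
  { MonoidAlgebra.lift ℂ B (FreeMonoid (X × Bool))
      (FreeMonoid.lift fun l : X × Bool => if l.2 then star (f l.1) else f l.1) with
    map_star' := fun a => by
      change MonoidAlgebra.lift ℂ B _ _ _ = star (MonoidAlgebra.lift ℂ B _ _ _)
      induction a using induction' with
      | h1 => simp
      | hl l => rw [star_letter]; rcases l with ⟨x, _ | _⟩ <;> simp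
      | hm a b ha hb => simp only [star_mul, map_mul, ha, hb]
      | ha a b ha hb => simp only [star_add, map_add, ha, hb]
      | hs c a ha => simp only [star_smul, map_smul, ha] }

theorem eval_gen {B : Type*} [Ring B] [StarRing B] [Algebra ℂ B] [StarModule ℂ B] (f : X → B)
    (x : X) : eval f (gen x) = f x := by
  change MonoidAlgebra.lift ℂ B _ _ (MonoidAlgebra.single _ _) = _
  simp

theorem eval_star {B : Type*} [Ring B] [StarRing B] [Algebra ℂ B] [StarModule ℂ B] (f : X → B)
    (a : FreeStarAlg X) : eval f (star a) = star (eval f a) := map_star (eval f) a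

end FreeStarAlg

/-! ### The universal unital C*-algebra on contractive generators with relations -/

/-- `q` is a C*-seminorm on the free `*`-algebra for which the generators are contractions and
which vanishes on the relators in `R`. -/
structure IsAdmissible {X : Type} (R : Set (FreeStarAlg X)) (q : Seminorm ℂ (FreeStarAlg X)) :
    Prop where
  mul_le : ∀ a b, q (a * b) ≤ q a * q b
  star_mul_self : ∀ a, q (star a * a) = q a ^ 2
  gen_le : ∀ x, q (FreeStarAlg.gen x) ≤ 1
  rel : ∀ r ∈ R, q r = 0

namespace IsAdmissible

variable {X : Type} {R : Set (FreeStarAlg X)} {q : Seminorm ℂ (FreeStarAlg X)}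

theorem le_star (h : IsAdmissible R q) (a : FreeStarAlg X) : q a ≤ q (star a) := by
  rcases (apply_nonneg q a).eq_or_lt with h0 | h0
  · rw [← h0]; exact apply_nonneg q _
  · have h1 := h.star_mul_self a
    have h2 := h.mul_le (star a) a
    rw [h1, pow_two] at h2
    exact le_of_mul_le_mul_right h2 h0

theorem star_eq (h : IsAdmissible R q) (a : FreeStarAlg X) : q (star a) = q a :=
  le_antisymm (by simpa using h.le_star (star a)) (h.le_star a)

theorem one_le (h : IsAdmissible R q) : q 1 ≤ 1 := by
  have h1 := h.star_mul_self 1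
  rw [star_one, one_mul] at h1
  nlinarith [apply_nonneg q 1]

theorem zero : IsAdmissible R (0 : Seminorm ℂ (FreeStarAlg X)) where
  mul_le := by simp
  star_mul_self := by simp
  gen_le := by simp
  rel := by simp

end IsAdmissible

namespace FreeStarAlg

variable {X : Type} (R : Set (FreeStarAlg X))

theorem exists_bound (a : FreeStarAlg X) :
    ∃ C : ℝ, 0 ≤ C ∧ ∀ q : Seminorm ℂ (FreeStarAlg X), IsAdmissible R q → q a ≤ C := by
  induction a using induction' with
  | h1 => exact ⟨1, zero_le_one, fun q hq => hq.one_le⟩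
  | hl l =>
    refine ⟨1, zero_le_one, fun q hq => ?_⟩
    rcases l with ⟨x, _ | _⟩
    · exact hq.gen_le x
    · have h := star_letter (x, false)
      change _ = MonoidAlgebra.single (FreeMonoid.of (x, true)) (1 : ℂ) at h
      rw [← h, hq.star_eq]
      exact hq.gen_le x
  | hm a b ha hb =>
    obtain ⟨C, hC, h⟩ := ha
    obtain ⟨D, hD, k⟩ := hb
    exact ⟨C * D, mul_nonneg hC hD, fun q hq => (hq.mul_le a b).trans
      (mul_le_mul (h q hq) (k q hq) (apply_nonneg q b) hC)⟩
  | ha a b ha hb =>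
    obtain ⟨C, hC, h⟩ := ha
    obtain ⟨D, hD, k⟩ := hb
    exact ⟨C + D, add_nonneg hC hD, fun q hq => (map_add_le_add q a b).trans
      (add_le_add (h q hq) (k q hq))⟩
  | hs c a ha =>
    obtain ⟨C, hC, h⟩ := ha
    exact ⟨‖c‖ * C, by positivity, fun q hq => by
      rw [map_smul_eq_mul]; exact mul_le_mul_of_nonneg_left (h q hq) (norm_nonneg c)⟩

/-- The largest admissible C*-seminorm: the supremum of all of them. -/
def univNorm (a : FreeStarAlg X) : ℝ :=
  ⨆ q : {q : Seminorm ℂ (FreeStarAlg X) // IsAdmissible R q}, q.1 a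

instance : Nonempty {q : Seminorm ℂ (FreeStarAlg X) // IsAdmissible R q} :=
  ⟨⟨0, IsAdmissible.zero⟩⟩

variable {R}

theorem le_univNorm {q : Seminorm ℂ (FreeStarAlg X)} (hq : IsAdmissible R q)
    (a : FreeStarAlg X) : q a ≤ univNorm R a := by
  obtain ⟨C, -, h⟩ := exists_bound R a
  exact le_ciSup (f := fun q : {q : Seminorm ℂ (FreeStarAlg X) // IsAdmissible R q} => q.1 a)
    ⟨C, by rintro _ ⟨q, rfl⟩; exact h q.1 q.2⟩ ⟨q, hq⟩

theorem univNorm_le {a : FreeStarAlg X} {C : ℝ}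
    (h : ∀ q : Seminorm ℂ (FreeStarAlg X), IsAdmissible R q → q a ≤ C) : univNorm R a ≤ C :=
  ciSup_le fun q => h q.1 q.2

theorem univNorm_nonneg (a : FreeStarAlg X) : 0 ≤ univNorm R a :=
  (apply_nonneg (0 : Seminorm ℂ (FreeStarAlg X)) a).trans (le_univNorm IsAdmissible.zero a)

theorem univNorm_smul_le (c : ℂ) (a : FreeStarAlg X) :
    univNorm R (c • a) ≤ ‖c‖ * univNorm R a :=
  univNorm_le fun q hq => by
    rw [map_smul_eq_mul]
    exact mul_le_mul_of_nonneg_left (le_univNorm hq a) (norm_nonneg c)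

theorem univNorm_mul_le (a b : FreeStarAlg X) :
    univNorm R (a * b) ≤ univNorm R a * univNorm R b :=
  univNorm_le fun q hq => (hq.mul_le a b).trans
    (mul_le_mul (le_univNorm hq a) (le_univNorm hq b) (apply_nonneg q b) (univNorm_nonneg a))

theorem univNorm_star (a : FreeStarAlg X) : univNorm R (star a) = univNorm R a := by
  unfold univNorm
  exact iSup_congr fun q => q.2.star_eq a

theorem univNorm_sq_le (a : FreeStarAlg X) :
    univNorm R a * univNorm R a ≤ univNorm R (star a * a) := by
  have h : univNorm R a ≤ Real.sqrt (univNorm R (star a * a)) :=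
    univNorm_le fun q hq => Real.le_sqrt_of_sq_le
      ((hq.star_mul_self a).symm.le.trans (le_univNorm hq _))
  calc univNorm R a * univNorm R a
      ≤ Real.sqrt (univNorm R (star a * a)) * Real.sqrt (univNorm R (star a * a)) :=
        mul_self_le_mul_self (univNorm_nonneg a) h
    _ = _ := Real.mul_self_sqrt (univNorm_nonneg _)

end FreeStarAlg

open FreeStarAlg in
/-- The free `*`-algebra on `X` as a seminormed algebra under the largest admissible
C*-seminorm. -/
def PreUniv {X : Type} (_R : Set (FreeStarAlg X)) : Type := FreeStarAlg X

namespace PreUniv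

open FreeStarAlg

variable {X : Type} (R : Set (FreeStarAlg X))

instance : Ring (PreUniv R) := inferInstanceAs (Ring (FreeStarAlg X))
instance : StarRing (PreUniv R) := inferInstanceAs (StarRing (FreeStarAlg X))
instance : Algebra ℂ (PreUniv R) := inferInstanceAs (Algebra ℂ (FreeStarAlg X))
instance : StarModule ℂ (PreUniv R) := inferInstanceAs (StarModule ℂ (FreeStarAlg X))

/-- The universal seminorm, as a ring seminorm. -/
def ringSeminorm : RingSeminorm (PreUniv R) where
  toFun a := univNorm R a
  map_zero' := le_antisymm (univNorm_le fun q _ => (map_zero q).le) (univNorm_nonneg _)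
  add_le' a b := univNorm_le fun q hq => (map_add_le_add q _ _).trans
    (add_le_add (le_univNorm hq a) (le_univNorm hq b))
  neg' a := by
    unfold univNorm
    exact iSup_congr fun q => map_neg_eq_map q.1 a
  mul_le' a b := univNorm_mul_le a b

instance : SeminormedRing (PreUniv R) :=
  { (ringSeminorm R).toSeminormedRing with
    toRing := inferInstanceAs (Ring (PreUniv R)) }

theorem norm_def (a : PreUniv R) : ‖a‖ = univNorm R a := rfl

instance : NormedAlgebra ℂ (PreUniv R) where
  norm_smul_le c a := univNorm_smul_le c a

instance : NormedStarGroup (PreUniv R) where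
  norm_star_le a := (univNorm_star (R := R) a).le

end PreUniv

/-- The universal unital C*-algebra generated by contractions `x ∈ X` subject to the
relations `r = 0`, `r ∈ R`: the Hausdorff completion of the free `*`-algebra for the largest
admissible C*-seminorm. -/
def UnivCStar {X : Type} (R : Set (FreeStarAlg X)) : Type :=
  UniformSpace.Completion (PreUniv R)

namespace UnivCStar

open UniformSpace FreeStarAlg

variable {X : Type} (R : Set (FreeStarAlg X))

instance : NormedRing (UnivCStar R) := inferInstanceAs (NormedRing (Completion (PreUniv R)))
instance : CompleteSpace (UnivCStar R) :=
  inferInstanceAs (CompleteSpace (Completion (PreUniv R)))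
instance : Algebra ℂ (UnivCStar R) := inferInstanceAs (Algebra ℂ (Completion (PreUniv R)))
instance : NormedAlgebra ℂ (UnivCStar R) where
  norm_smul_le c a := norm_smul_le (α := ℂ) (β := Completion (PreUniv R)) c a

/-- The canonical map of the free `*`-algebra into the universal C*-algebra. -/
def coe (a : PreUniv R) : UnivCStar R := (a : Completion (PreUniv R))

theorem continuous_coe : Continuous (coe R) := Completion.continuous_coe _

theorem denseRange_coe : DenseRange (coe R) := Completion.denseRange_coe

theorem norm_coe (a : PreUniv R) : ‖coe R a‖ = univNorm R a := Completion.norm_coe _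

theorem uniformContinuous_star : UniformContinuous (star : PreUniv R → PreUniv R) :=
  (AddMonoidHomClass.isometry_of_norm (starAddEquiv : PreUniv R ≃+ PreUniv R)
    (fun a => norm_star a)).uniformContinuous

/-- The continuous extension of the adjoint to the completion. -/
def starFun : UnivCStar R → UnivCStar R :=
  Completion.map (star : PreUniv R → PreUniv R)

theorem continuous_starFun : Continuous (starFun R) := Completion.continuous_map

theorem starFun_coe (a : PreUniv R) : starFun R (coe R a) = coe R (star a) :=
  Completion.map_coe (uniformContinuous_star R) a

variable {R}

theorem coe_add (a b : PreUniv R) : coe R (a + b) = coe R a + coe R b := Completion.coe_add a b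
theorem coe_mul (a b : PreUniv R) : coe R (a * b) = coe R a * coe R b := Completion.coe_mul a b
theorem coe_smul (c : ℂ) (a : PreUniv R) : coe R (c • a) = c • coe R a := Completion.coe_smul c a
theorem coe_one : coe R 1 = 1 := rfl
theorem coe_zero : coe R 0 = 0 := rfl

theorem ind {p : UnivCStar R → Prop} (hc : IsClosed {a | p a}) (h : ∀ a, p (coe R a))
    (a : UnivCStar R) : p a := Completion.induction_on a hc h

theorem ind₂ {p : UnivCStar R → UnivCStar R → Prop} (hc : IsClosed {a : _ × _ | p a.1 a.2})
    (h : ∀ a b, p (coe R a) (coe R b)) (a b : UnivCStar R) : p a b :=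
  Completion.induction_on₂ a b hc h

instance : StarRing (UnivCStar R) where
  star := starFun R
  star_involutive a := by
    refine ind (p := fun a => starFun R (starFun R a) = a) ?_ (fun a => ?_) a
    · exact isClosed_eq ((continuous_starFun R).comp (continuous_starFun R)) continuous_id
    · rw [starFun_coe, starFun_coe, star_star]
  star_mul a b := by
    refine ind₂ (p := fun a b => starFun R (a * b) = starFun R b * starFun R a) ?_
      (fun a b => ?_) a b
    · have := continuous_starFun R
      exact isClosed_eq (by fun_prop) (by fun_prop)
    · rw [← coe_mul, starFun_coe, starFun_coe, starFun_coe, ← coe_mul, star_mul]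
  star_add a b := by
    refine ind₂ (p := fun a b => starFun R (a + b) = starFun R a + starFun R b) ?_
      (fun a b => ?_) a b
    · have := continuous_starFun R
      exact isClosed_eq (by fun_prop) (by fun_prop)
    · rw [← coe_add, starFun_coe, starFun_coe, starFun_coe, ← coe_add, star_add]

theorem continuous_star' : Continuous (star : UnivCStar R → UnivCStar R) := continuous_starFun R

theorem coe_star (a : PreUniv R) : coe R (star a) = star (coe R a) := (starFun_coe R a).symm

instance : StarModule ℂ (UnivCStar R) where
  star_smul c a := by
    refine ind (p := fun a => star (c • a) = star c • star a) ?_ (fun a => ?_) a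
    · exact isClosed_eq (continuous_star'.comp (continuous_const_smul c))
        ((continuous_const_smul (star c)).comp continuous_star')
    · rw [← coe_smul, ← coe_star, ← coe_star, ← coe_smul, star_smul]

instance : CStarRing (UnivCStar R) where
  norm_mul_self_le a := by
    refine ind (p := fun a => ‖a‖ * ‖a‖ ≤ ‖star a * a‖) ?_ (fun a => ?_) a
    · have := continuous_star' (R := R)
      exact isClosed_le (by fun_prop) (by fun_prop)
    · rw [← coe_star, ← coe_mul, norm_coe, norm_coe]
      exact univNorm_sq_le (R := R) a

instance : CStarAlgebra (UnivCStar R) where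

/-- The canonical generators of the universal C*-algebra. -/
def gen (x : X) : UnivCStar R := coe R (FreeStarAlg.gen x)

variable (R) in
/-- The canonical `*`-homomorphism of the free `*`-algebra into the universal C*-algebra. -/
def coeHom : FreeStarAlg X →⋆ₐ[ℂ] UnivCStar R where
  toFun a := coe R a
  map_one' := rfl
  map_mul' := coe_mul
  map_zero' := rfl
  map_add' := coe_add
  commutes' c := by
    rw [Algebra.algebraMap_eq_smul_one, Algebra.algebraMap_eq_smul_one]
    exact coe_smul c 1
  map_star' := coe_star

theorem coeHom_gen (x : X) : coeHom R (FreeStarAlg.gen x) = gen x := rfl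

theorem coeHom_rel {r : FreeStarAlg X} (hr : r ∈ R) : coeHom R r = 0 := by
  rw [← norm_eq_zero]
  refine (norm_coe R r).trans ?_
  exact le_antisymm (univNorm_le fun q hq => (hq.rel r hr).le) (univNorm_nonneg r)

section lift

variable {B : Type*} [CStarAlgebra B] {f : X → B}

theorem isAdmissible_eval (hf : ∀ x, ‖f x‖ ≤ 1) (hR : ∀ r ∈ R, eval f r = 0) :
    IsAdmissible R ((normSeminorm ℂ B).comp (eval f).toAlgHom.toLinearMap) where
  mul_le a b := by
    change ‖eval f (a * b)‖ ≤ ‖eval f a‖ * ‖eval f b‖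
    rw [map_mul]; exact norm_mul_le _ _
  star_mul_self a := by
    change ‖eval f (star a * a)‖ = ‖eval f a‖ ^ 2
    rw [map_mul, map_star, CStarRing.norm_star_mul_self, pow_two]
  gen_le x := by
    change ‖eval f (FreeStarAlg.gen x)‖ ≤ 1
    rw [eval_gen]; exact hf x
  rel r hr := by
    change ‖eval f r‖ = 0
    rw [hR r hr, norm_zero]

theorem norm_eval_le (hf : ∀ x, ‖f x‖ ≤ 1) (hR : ∀ r ∈ R, eval f r = 0) (a : FreeStarAlg X) :
    ‖eval f a‖ ≤ univNorm R a :=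
  le_univNorm (isAdmissible_eval hf hR) a

variable (R f) in
/-- Evaluation, as an additive map on the seminormed free `*`-algebra. -/
def preEval : PreUniv R →+ B :=
  (eval f : FreeStarAlg X →⋆ₐ[ℂ] B).toAlgHom.toLinearMap.toAddMonoidHom

theorem uniformContinuous_preEval (hf : ∀ x, ‖f x‖ ≤ 1) (hR : ∀ r ∈ R, eval f r = 0) :
    UniformContinuous (preEval R f) :=
  uniformContinuous_addMonoidHom_of_continuous
    (AddMonoidHomClass.continuous_of_bound (preEval R f) 1
      (fun a => by rw [one_mul]; exact norm_eval_le hf hR a))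

variable (R) in
/-- The continuous extension of evaluation to the completion. -/
def liftFun (f : X → B) : UnivCStar R → B :=
  Completion.extension (preEval R f)

variable (R) in
theorem continuous_liftFun (f : X → B) : Continuous (liftFun R f) := Completion.continuous_extension

theorem liftFun_coe (hf : ∀ x, ‖f x‖ ≤ 1) (hR : ∀ r ∈ R, eval f r = 0) (a : PreUniv R) :
    liftFun R f (coe R a) = preEval R f a :=
  Completion.extension_coe (uniformContinuous_preEval hf hR) a

/-- The universal property: contractions in a unital C*-algebra satisfying the relations are
the images of the generators under a unital `*`-homomorphism. -/
def lift (f : X → B) (hf : ∀ x, ‖f x‖ ≤ 1) (hR : ∀ r ∈ R, eval f r = 0) :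
    UnivCStar R →⋆ₐ[ℂ] B where
  toFun := liftFun R f
  map_one' := (liftFun_coe hf hR 1).trans (map_one (eval f))
  map_zero' := (liftFun_coe hf hR 0).trans (map_zero (eval f))
  map_mul' a b := by
    have := continuous_liftFun R f
    refine ind₂ (p := fun a b => liftFun R f (a * b) = liftFun R f a * liftFun R f b)
      (isClosed_eq (by fun_prop) (by fun_prop)) (fun a b => ?_) a b
    rw [← coe_mul, liftFun_coe hf hR, liftFun_coe hf hR, liftFun_coe hf hR]
    exact map_mul (eval f) _ _
  map_add' a b := by
    have := continuous_liftFun R f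
    refine ind₂ (p := fun a b => liftFun R f (a + b) = liftFun R f a + liftFun R f b)
      (isClosed_eq (by fun_prop) (by fun_prop)) (fun a b => ?_) a b
    rw [← coe_add, liftFun_coe hf hR, liftFun_coe hf hR, liftFun_coe hf hR]
    exact map_add (preEval R f) _ _
  commutes' c := by
    have h : algebraMap ℂ (UnivCStar R) c = coe R (algebraMap ℂ (FreeStarAlg X) c) :=
      ((coeHom R).toAlgHom.commutes c).symm
    rw [h]
    refine (liftFun_coe hf hR _).trans ?_
    exact (eval f).toAlgHom.commutes c
  map_star' a := by
    have := continuous_liftFun R f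
    have h' := continuous_star' (R := R)
    refine ind (p := fun a => liftFun R f (star a) = star (liftFun R f a))
      (isClosed_eq (by fun_prop) (by fun_prop)) (fun a => ?_) a
    rw [← coe_star, liftFun_coe hf hR, liftFun_coe hf hR]
    exact map_star (eval f) _

theorem lift_gen (hf : ∀ x, ‖f x‖ ≤ 1) (hR : ∀ r ∈ R, eval f r = 0) (x : X) :
    lift f hf hR (gen x) = f x :=
  (liftFun_coe hf hR _).trans (eval_gen f x)

/-- Unital `*`-homomorphisms out of the universal C*-algebra agree if they agree on the
generators. -/
theorem hom_ext {φ ψ : UnivCStar R →⋆ₐ[ℂ] B} (h : ∀ x, φ (gen x) = ψ (gen x)) : φ = ψ := by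
  have hφ : Continuous φ :=
    AddMonoidHomClass.continuous_of_bound φ 1
      (fun a => by rw [one_mul]; exact NonUnitalStarAlgHom.norm_apply_le φ a)
  have hψ : Continuous ψ :=
    AddMonoidHomClass.continuous_of_bound ψ 1
      (fun a => by rw [one_mul]; exact NonUnitalStarAlgHom.norm_apply_le ψ a)
  refine StarAlgHom.ext fun a => ?_
  refine ind (p := fun a => φ a = ψ a) (isClosed_eq hφ hψ) (fun a => ?_) a
  change φ (coeHom R a) = ψ (coeHom R a)
  induction a using induction' with
  | h1 => simp
  | hl l =>
    rcases l with ⟨x, _ | _⟩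
    · exact h x
    · have h1 := star_letter (x, false)
      change star (FreeStarAlg.gen x) = MonoidAlgebra.single (FreeMonoid.of (x, true)) (1 : ℂ) at h1
      rw [← h1, map_star, map_star, map_star]
      exact congrArg star (h x)
  | hm a b ha hb => simp only [map_mul, ha, hb]
  | ha a b ha hb => simp only [map_add, ha, hb]
  | hs c a ha => simp only [map_smul, ha]

end lift

end UnivCStar

theorem norm_le_one_of_isometry {B : Type*} [CStarAlgebra B] {s : B} (h : star s * s = 1) :
    ‖s‖ ≤ 1 := by
  have h1 : ‖(1 : B)‖ * ‖(1 : B)‖ = ‖(1 : B)‖ := by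
    have := CStarRing.norm_star_mul_self (x := (1 : B))
    rw [star_one, one_mul] at this
    exact this.symm
  have h2 : ‖s‖ * ‖s‖ = ‖(1 : B)‖ := by rw [← CStarRing.norm_star_mul_self, h]
  have h3 : ‖(1 : B)‖ ≤ 1 := by nlinarith [norm_nonneg (1 : B)]
  nlinarith [norm_nonneg s]

/-! ### The Cuntz algebra `O₂` -/

/-- The relators of the Cuntz algebra: two isometries whose range projections sum to `1`. The
letters `1, 2` of the usual notation are `0, 1 : Fin 2`. -/
def o2Rel : Set (FreeStarAlg (Fin 2)) :=
  {r | (∃ i, r = star (FreeStarAlg.gen i) * FreeStarAlg.gen i - 1) ∨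
    r = FreeStarAlg.gen 0 * star (FreeStarAlg.gen 0) +
      FreeStarAlg.gen 1 * star (FreeStarAlg.gen 1) - 1}

/-- The Cuntz algebra `O₂`: the universal C*-algebra generated by two isometries `S₁, S₂` with
`S₁S₁* + S₂S₂* = 1`. -/
abbrev O2 : Type := UnivCStar o2Rel

namespace O2

/-- The generating isometries: `S 0` is `S₁` and `S 1` is `S₂`. -/
def S (i : Fin 2) : O2 := UnivCStar.gen i

theorem isometry_S (i : Fin 2) : star (S i) * S i = 1 := by
  have h := UnivCStar.coeHom_rel (R := o2Rel) (Or.inl ⟨i, rfl⟩)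
  simp only [map_sub, map_mul, map_star, map_one, UnivCStar.coeHom_gen] at h
  exact sub_eq_zero.mp h

theorem range_S : S 0 * star (S 0) + S 1 * star (S 1) = 1 := by
  have h := UnivCStar.coeHom_rel (R := o2Rel) (Or.inr rfl)
  simp only [map_sub, map_add, map_mul, map_star, map_one, UnivCStar.coeHom_gen] at h
  exact sub_eq_zero.mp h

variable {B : Type*} [CStarAlgebra B]

/-- The universal property of `O₂`. -/
def lift (s : Fin 2 → B) (h : ∀ i, star (s i) * s i = 1)
    (h' : s 0 * star (s 0) + s 1 * star (s 1) = 1) : O2 →⋆ₐ[ℂ] B :=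
  UnivCStar.lift s (fun i => norm_le_one_of_isometry (h i)) (by
    rintro r (⟨i, rfl⟩ | rfl)
    · simp [FreeStarAlg.eval_star, FreeStarAlg.eval_gen, h]
    · simp [FreeStarAlg.eval_star, FreeStarAlg.eval_gen, h'])

theorem lift_S (s : Fin 2 → B) (h : ∀ i, star (s i) * s i = 1)
    (h' : s 0 * star (s 0) + s 1 * star (s 1) = 1) (i : Fin 2) : lift s h h' (S i) = s i :=
  UnivCStar.lift_gen _ _ i

theorem hom_ext {φ ψ : O2 →⋆ₐ[ℂ] B} (h : ∀ i, φ (S i) = ψ (S i)) : φ = ψ :=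
  UnivCStar.hom_ext h

end O2

/-! ### The 2-adic ring C*-algebra `Q₂` -/

/-- The two generators of `Q₂`. -/
inductive Q2Gen : Type
  | u : Q2Gen
  | s : Q2Gen

/-- The relators of `Q₂`: `U` is unitary, `S₂` is an isometry, `S₂U = U²S₂` and
`S₂S₂* + US₂S₂*U* = 1`. -/
def q2Rel : Set (FreeStarAlg Q2Gen) :=
  {star (FreeStarAlg.gen .u) * FreeStarAlg.gen .u - 1,
    FreeStarAlg.gen .u * star (FreeStarAlg.gen .u) - 1,
    star (FreeStarAlg.gen .s) * FreeStarAlg.gen .s - 1,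
    FreeStarAlg.gen .s * FreeStarAlg.gen .u - FreeStarAlg.gen .u ^ 2 * FreeStarAlg.gen .s,
    FreeStarAlg.gen .s * star (FreeStarAlg.gen .s) +
      FreeStarAlg.gen .u * FreeStarAlg.gen .s * star (FreeStarAlg.gen .s) *
        star (FreeStarAlg.gen .u) - 1}

/-- The 2-adic ring C*-algebra `Q₂`: the universal C*-algebra generated by a unitary `U` and an
isometry `S₂` with `S₂U = U²S₂` and `S₂S₂* + US₂S₂*U* = 1`. -/
abbrev Q2 : Type := UnivCStar q2Rel

namespace Q2

/-- The generating unitary. -/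
def U : Q2 := UnivCStar.gen .u

/-- The generating isometry. -/
def S₂ : Q2 := UnivCStar.gen .s

theorem star_U_mul_U : star U * U = 1 := by
  have h := UnivCStar.coeHom_rel (R := q2Rel) (Or.inl rfl)
  simp only [map_sub, map_mul, map_star, map_one, UnivCStar.coeHom_gen] at h
  exact sub_eq_zero.mp h

theorem U_mul_star_U : U * star U = 1 := by
  have h := UnivCStar.coeHom_rel (R := q2Rel) (Or.inr (Or.inl rfl))
  simp only [map_sub, map_mul, map_star, map_one, UnivCStar.coeHom_gen] at h
  exact sub_eq_zero.mp h

theorem star_S₂_mul_S₂ : star S₂ * S₂ = 1 := by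
  have h := UnivCStar.coeHom_rel (R := q2Rel) (Or.inr (Or.inr (Or.inl rfl)))
  simp only [map_sub, map_mul, map_star, map_one, UnivCStar.coeHom_gen] at h
  exact sub_eq_zero.mp h

theorem S₂_mul_U : S₂ * U = U ^ 2 * S₂ := by
  have h := UnivCStar.coeHom_rel (R := q2Rel) (Or.inr (Or.inr (Or.inr (Or.inl rfl))))
  simp only [map_sub, map_mul, map_pow, UnivCStar.coeHom_gen] at h
  exact sub_eq_zero.mp h

theorem range_S₂ : S₂ * star S₂ + U * S₂ * star S₂ * star U = 1 := by
  have h := UnivCStar.coeHom_rel (R := q2Rel) (Or.inr (Or.inr (Or.inr (Or.inr rfl))))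
  simp only [map_sub, map_add, map_mul, map_star, map_one, UnivCStar.coeHom_gen] at h
  exact sub_eq_zero.mp h

variable {B : Type*} [CStarAlgebra B]

/-- The universal property of `Q₂`. -/
def lift (u s : B) (hu : star u * u = 1) (hu' : u * star u = 1) (hs : star s * s = 1)
    (hsu : s * u = u ^ 2 * s) (h : s * star s + u * s * star s * star u = 1) : Q2 →⋆ₐ[ℂ] B :=
  UnivCStar.lift (fun g => match g with | .u => u | .s => s)
    (by rintro (_ | _)
        · exact norm_le_one_of_isometry hu
        · exact norm_le_one_of_isometry hs) (by
    rintro r (rfl | rfl | rfl | rfl | rfl)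
    · simp [FreeStarAlg.eval_star, FreeStarAlg.eval_gen, hu]
    · simp [FreeStarAlg.eval_star, FreeStarAlg.eval_gen, hu']
    · simp [FreeStarAlg.eval_star, FreeStarAlg.eval_gen, hs]
    · simp [FreeStarAlg.eval_gen, hsu]
    · simp [FreeStarAlg.eval_star, FreeStarAlg.eval_gen, h])

theorem lift_U (u s : B) (hu : star u * u = 1) (hu' : u * star u = 1) (hs : star s * s = 1)
    (hsu : s * u = u ^ 2 * s) (h : s * star s + u * s * star s * star u = 1) :
    lift u s hu hu' hs hsu h U = u := UnivCStar.lift_gen _ _ _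

theorem lift_S₂ (u s : B) (hu : star u * u = 1) (hu' : u * star u = 1) (hs : star s * s = 1)
    (hsu : s * u = u ^ 2 * s) (h : s * star s + u * s * star s * star u = 1) :
    lift u s hu hu' hs hsu h S₂ = s := UnivCStar.lift_gen _ _ _

theorem hom_ext {φ ψ : Q2 →⋆ₐ[ℂ] B} (hU : φ U = ψ U) (hS : φ S₂ = ψ S₂) : φ = ψ :=
  UnivCStar.hom_ext (by rintro (_ | _); exacts [hU, hS])

end Q2

/-- The inclusion `O₂ ⊂ Q₂`, with `S₁ ↦ US₂` and `S₂ ↦ S₂`. -/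
def O2.incl : O2 →⋆ₐ[ℂ] Q2 :=
  O2.lift ![Q2.U * Q2.S₂, Q2.S₂]
    (by
      intro i
      fin_cases i
      · change star (Q2.U * Q2.S₂) * (Q2.U * Q2.S₂) = 1
        rw [star_mul, mul_assoc, ← mul_assoc (star Q2.U), Q2.star_U_mul_U, one_mul,
          Q2.star_S₂_mul_S₂]
      · exact Q2.star_S₂_mul_S₂)
    (by
      change Q2.U * Q2.S₂ * star (Q2.U * Q2.S₂) + Q2.S₂ * star Q2.S₂ = 1
      rw [star_mul, ← mul_assoc, add_comm, Q2.range_S₂])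

/-! ### States -/

section States

variable {A : Type*} [CStarAlgebra A]

/-- A state: a positive linear functional with `ω 1 = 1`. -/
structure IsState (ω : A →ₗ[ℂ] ℂ) : Prop where
  nonneg : ∀ a, 0 ≤ ω (star a * a)
  map_one : ω 1 = 1

/-- A pure state: an extreme point of the convex set of states. -/
def IsPureState (ω : A →ₗ[ℂ] ℂ) : Prop :=
  ω ∈ Set.extremePoints ℝ {φ : A →ₗ[ℂ] ℂ | IsState φ}

end States

/-- A pure state `ω` of `O₂` with the unique extension property for `O₂ ⊂ Q₂`: exactly one pure
state of `Q₂` restricts to `ω`. -/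
def HasUniquePureExtension (ω : O2 →ₗ[ℂ] ℂ) : Prop :=
  IsPureState ω ∧
    ∃! Ω : Q2 →ₗ[ℂ] ℂ, IsPureState Ω ∧ Ω ∘ₗ O2.incl.toAlgHom.toLinearMap = ω

/-! ### Representations -/

section Representations

variable {H : Type*} [NormedAddCommGroup H] [InnerProductSpace ℂ H] [CompleteSpace H]

/-- The functional `T ↦ (π(T)x, x)`; the inner product of Mathlib is conjugate linear in its
first argument. -/
def vectorState {A : Type*} [CStarAlgebra A] (π : A →⋆ₐ[ℂ] (H →L[ℂ] H)) (x : H) :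
    A →ₗ[ℂ] ℂ where
  toFun T := inner ℂ x (π T x)
  map_add' S T := by simp
  map_smul' c T := by simp

/-- Irreducibility: the space is nonzero and has no closed invariant subspaces besides `0` and
the whole space. -/
def IsIrreducibleRep {A : Type*} [CStarAlgebra A] (π : A →⋆ₐ[ℂ] (H →L[ℂ] H)) : Prop :=
  Nontrivial H ∧ ∀ K : Submodule ℂ H, IsClosed (K : Set H) →
    (∀ T, ∀ v ∈ K, π T v ∈ K) → K = ⊥ ∨ K = ⊤

/-- A pure isometry: `⋂_{n ≥ 1} Ran(Vⁿ) = 0`. -/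
def IsPureIsometry (V : H →L[ℂ] H) : Prop :=
  star V * V = 1 ∧ ⨅ n : ℕ, LinearMap.range ((V ^ (n + 1) : H →L[ℂ] H) : H →ₗ[ℂ] H) = ⊥

/-- `π` is permutative: `π(S_i) e_n = e_{σ_i(n)}` for the orthonormal basis `e` and the branching
function system `σ`. -/
structure IsPermutative (π : O2 →⋆ₐ[ℂ] (H →L[ℂ] H)) (e : HilbertBasis ℕ ℂ H)
    (σ : Fin 2 → ℕ → ℕ) : Prop where
  injective : ∀ i, Function.Injective (σ i)
  disjoint : Disjoint (Set.range (σ 0)) (Set.range (σ 1))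
  union : Set.range (σ 0) ∪ Set.range (σ 1) = Set.univ
  map_S : ∀ i n, π (O2.S i) (e n) = e (σ i n)

/-- A finite or infinite multi-index in the alphabet of `S`. -/
inductive MultiIndex : Type
  | finite (w : List (Fin 2)) : MultiIndex
  | infinite (w : ℕ → Fin 2) : MultiIndex

/-- The length `|I|`. -/
def MultiIndex.length : MultiIndex → ℕ∞
  | .finite w => w.length
  | .infinite _ => ⊤

/-- `S_w = S_{i₁} S_{i₂} ⋯ S_{i_k}` for `w = (i₁, …, i_k)`. -/
def O2.word (w : List (Fin 2)) : O2 := (w.map O2.S).prod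

/-- The condition on the distinguished vector `v` of a representation of type `P(I)`.
If `I` is finite: `S_I v = v`, and `v, S_{i₁} v, …, S_{i₁} ⋯ S_{i_{k-1}} v` are orthonormal.
If `I` is infinite: the vectors `(S_{i₁} ⋯ S_{i_n})* v`, `n ≥ 0`, are orthonormal (in particular
they are nonzero). -/
def IsTypePVector (π : O2 →⋆ₐ[ℂ] (H →L[ℂ] H)) (v : H) : MultiIndex → Prop
  | .finite w => π (O2.word w) v = v ∧
      Orthonormal ℂ fun j : Fin w.length => π (O2.word (w.take j)) v
  | .infinite w => Orthonormal ℂ fun n : ℕ =>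
      π (star (O2.word (List.ofFn fun j : Fin n => w j))) v

/-- `π` is a permutative representation of type `P(I)`: it is permutative with respect to some
orthonormal basis, one of whose members is cyclic and satisfies the condition attached to `I`. -/
def IsTypeP (π : O2 →⋆ₐ[ℂ] (H →L[ℂ] H)) (I : MultiIndex) : Prop :=
  ∃ (e : HilbertBasis ℕ ℂ H) (σ : Fin 2 → ℕ → ℕ) (k : ℕ), IsPermutative π e σ ∧
    Dense (Set.range fun T : O2 => π T (e k)) ∧ IsTypePVector π (e k) I

end Representations

end

noncomputable section

/-! ### States and irreducible representations: GNS, intertwiners, Schur's lemma, purity of vector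
states. -/

section General

variable {A : Type*} [CStarAlgebra A]
variable {H : Type*} [NormedAddCommGroup H] [InnerProductSpace ℂ H] [CompleteSpace H]
variable {K : Type*} [NormedAddCommGroup K] [InnerProductSpace ℂ K] [CompleteSpace K]

/-! In `Q₂` the unitary satisfies `U = S₁S₂* + S₂US₁*`. Write `a`, `b` for the images of `S₁`, `S₂`
under `π`. The difference `D` of two solutions of `u = ab* + bua*` satisfies `D = bDa*`, hence `D =
bⁿDa*ⁿ`. A pure isometry has `a*ⁿ → 0` strongly, so `‖Dv‖ = ‖Da*ⁿv‖ → 0` and `D = 0`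
(`IsPureIsometry.eq_zero_of_sandwich`). The same decay makes the iterates from `0` converge to an
isometric solution `u` (`exists_isometry_fixed`). Exchanging `a` and `b` gives an isometric solution
of the equation satisfied by `u*`. Uniqueness, now from the purity of `b`, identifies it with `u*`,
so `u` is unitary and `π` extends to a representation `π'` of `Q₂` on the same space.

If a state `Ω` of `Q₂` restricts to `ω_x`, the GNS vector of `Ω` is the image of `x` under a bounded
intertwiner `W` of the `O₂`-actions. The defect `ρ(U)W - Wπ'(U)` satisfies the same sandwich
equation, so it vanishes and `W` intertwines the `Q₂`-actions. Hence `Ω` is the vector state of `π'`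
at `x`. Since this uniqueness is among all states, the extension is automatically pure: the parts of
a convex decomposition restrict to `ω_x`, which is pure.

For the corollary, suppose the image `V` of `S_i` is not pure. The intersection `M` of the ranges of
its powers reduces `V` to a unitary, and the other generator's adjoint kills `M`. Orthogonal
`V*`-invariant pieces of `M` generate orthogonal invariant subspaces, so irreducibility and the
functional calculus force `dim M ≤ 1` (`IsIrreducibleRep.coreRange_eq_zero_or`). In a permutative
representation `M` contains some basis vector `e m`, so `V` fixes it. By irreducibility the
distinguished vector reaches `e m` under the coding map. A finite index then has all its vectors
equal to `e m`, and an infinite one has an eventually constant sequence; both contradict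
orthonormality when `|I| ≥ 2`. -/

theorem vectorState_apply (π : A →⋆ₐ[ℂ] (H →L[ℂ] H)) (x : H) (a : A) :
    vectorState π x a = inner ℂ x (π a x) := rfl

theorem vectorState_star_mul_self (π : A →⋆ₐ[ℂ] (H →L[ℂ] H)) (x : H) (a : A) :
    vectorState π x (star a * a) = ((‖π a x‖ ^ 2 : ℝ) : ℂ) := by
  rw [vectorState_apply, map_mul, map_star, mul_apply_eq_comp,
    ContinuousLinearMap.star_eq_adjoint, ContinuousLinearMap.adjoint_inner_right,
    inner_self_eq_norm_sq_to_K]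
  simp

theorem isState_vectorState (π : A →⋆ₐ[ℂ] (H →L[ℂ] H)) {x : H} (hx : ‖x‖ = 1) :
    IsState (vectorState π x) where
  nonneg a := by
    rw [vectorState_star_mul_self]
    exact_mod_cast sq_nonneg ‖π a x‖
  map_one := by
    rw [vectorState_apply, map_one, one_apply_eq_self, inner_self_eq_norm_sq_to_K, hx]
    simp

/-- The Gelfand–Naimark–Segal theorem: every state is a vector state. -/
theorem IsState.exists_eq_vectorState.{u} {A : Type u} [CStarAlgebra A] {φ : A →ₗ[ℂ] ℂ}
    (hφ : IsState φ) :
    ∃ (K : Type u) (_ : NormedAddCommGroup K) (_ : InnerProductSpace ℂ K) (_ : CompleteSpace K)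
      (ρ : A →⋆ₐ[ℂ] (K →L[ℂ] K)) (ξ : K), φ = vectorState ρ ξ := by
  -- For the spectral order the nonnegative elements are exactly the `star b * b`, so `φ` becomes a
  -- positive map.
  let _ := CStarAlgebra.spectralOrder A
  have := CStarAlgebra.spectralOrderedRing A
  let f : A →ₚ[ℂ] ℂ := PositiveLinearMap.mk₀ φ (fun a ha => by
    obtain ⟨b, rfl⟩ := CStarAlgebra.nonneg_iff_eq_star_mul_self.mp ha
    exact hφ.nonneg b)
  refine ⟨f.GNS, inferInstance, inferInstance, inferInstance, f.gnsStarAlgHom,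
    ((f.toPreGNS 1 : f.PreGNS) : f.GNS), LinearMap.ext fun a => ?_⟩
  rw [vectorState_apply]
  change _ = inner ℂ _ (f.gnsNonUnitalStarAlgHom a _)
  rw [PositiveLinearMap.gnsNonUnitalStarAlgHom_apply_coe, UniformSpace.Completion.inner_coe,
    PositiveLinearMap.preGNS_inner_def]
  simp [f]
  rfl

/-- The closed cyclic subspace of a nonzero vector of an irreducible representation is the whole
space. -/
theorem IsIrreducibleRep.denseRange {π : A →⋆ₐ[ℂ] (H →L[ℂ] H)} (hπ : IsIrreducibleRep π) {x : H}
    (hx : x ≠ 0) :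
    DenseRange ((LinearMap.applyₗ x ∘ₗ ContinuousLinearMap.coeLM ℂ) ∘ₗ
      π.toAlgHom.toLinearMap : A →ₗ[ℂ] H) := by
  set f : A →ₗ[ℂ] H := (LinearMap.applyₗ x ∘ₗ ContinuousLinearMap.coeLM ℂ) ∘ₗ
      π.toAlgHom.toLinearMap with hf
  have hfa : ∀ a, f a = π a x := fun a => rfl
  have := hπ.2 (LinearMap.range f).topologicalClosure
    (Submodule.isClosed_topologicalClosure _) (fun T v hv => by
      have hm : Set.MapsTo (π T) (LinearMap.range f : Set H) (LinearMap.range f) := by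
        rintro _ ⟨a, rfl⟩
        exact ⟨T * a, by simp [hfa]⟩
      exact hm.closure (π T).continuous hv)
  rcases this with h | h
  · exfalso
    apply hx
    have : x ∈ (LinearMap.range f).topologicalClosure :=
      Submodule.le_topologicalClosure _ ⟨1, by simp [hfa]⟩
    rw [h] at this
    simpa using this
  · intro y
    have : y ∈ (LinearMap.range f).topologicalClosure := h ▸ Submodule.mem_top
    exact this

/-- A dominated vector of another representation is the image of a cyclic vector under a bounded
intertwiner. -/
theorem IsIrreducibleRep.exists_intertwiner {π : A →⋆ₐ[ℂ] (H →L[ℂ] H)} (hπ : IsIrreducibleRep π)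
    (ρ : A →⋆ₐ[ℂ] (K →L[ℂ] K)) {x : H} (hx : x ≠ 0) (ξ : K) {C : ℝ}
    (hC : ∀ a, ‖ρ a ξ‖ ≤ C * ‖π a x‖) :
    ∃ W : H →L[ℂ] K, W x = ξ ∧ ∀ a, W ∘L π a = ρ a ∘L W := by
  set e : A →ₗ[ℂ] H := (LinearMap.applyₗ x ∘ₗ ContinuousLinearMap.coeLM ℂ) ∘ₗ
    π.toAlgHom.toLinearMap
  have hd : DenseRange e := hπ.denseRange hx
  set f : A →ₗ[ℂ] K := (LinearMap.applyₗ ξ ∘ₗ ContinuousLinearMap.coeLM ℂ) ∘ₗ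
    ρ.toAlgHom.toLinearMap
  -- The bound `hC` makes `π a x ↦ ρ a ξ` well defined and bounded on a dense subspace.
  have hW : ∀ a, f.extendOfNorm e (π a x) = ρ a ξ :=
    LinearMap.extendOfNorm_eq (f := f) (e := e) hd ⟨C, hC⟩
  refine ⟨f.extendOfNorm e, by simpa using hW 1, fun a => ?_⟩
  ext v
  refine hd.induction_on (p := fun v => (f.extendOfNorm e ∘L π a) v = (ρ a ∘L f.extendOfNorm e) v)
    v (isClosed_eq (by fun_prop) (by fun_prop)) fun b => ?_
  have h1 := hW (a * b)
  rw [map_mul, map_mul] at h1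
  change f.extendOfNorm e (π a (π b x)) = ρ a (f.extendOfNorm e (π b x))
  rw [hW]
  exact h1

/-- A normal operator which is not a scalar has two nonzero functions of it with product zero. -/
theorem exists_mul_eq_zero_of_normal {N : A} (hN : IsStarNormal N)
    (h : ∀ c : ℂ, N ≠ algebraMap ℂ A c) :
    ∃ f g : ℂ → ℂ, cfc f N * cfc g N = 0 ∧ cfc f N ≠ 0 ∧ cfc g N ≠ 0 := by
  have hnt : Nontrivial A := ⟨⟨N, _, h 0⟩⟩
  obtain ⟨z, hz⟩ := spectrum.nonempty N
  -- A normal element whose spectrum is one point is scalar, so there is a second spectral point.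
  obtain ⟨w, hw, hzw⟩ : ∃ w ∈ spectrum ℂ N, w ≠ z := by
    by_contra! hc
    apply h z
    rw [← cfc_id' ℂ N, ← cfc_const z N]
    exact cfc_congr fun w hw => hc w hw
  set d := dist w z
  have hd : 0 < d := dist_pos.mpr hzw
  -- Bumps of radius `d / 2` about `z` and `w` have disjoint supports. By spectral mapping each
  -- yields a nonzero element, since it takes the value `d / 2` on the spectrum.
  let f : ℂ → ℂ := fun u => ((max (d / 2 - dist u z) 0 : ℝ) : ℂ)
  let g : ℂ → ℂ := fun u => ((max (d / 2 - dist u w) 0 : ℝ) : ℂ)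
  have hf : Continuous f := by fun_prop
  have hg : Continuous g := by fun_prop
  refine ⟨f, g, ?_, ?_, ?_⟩
  · rw [← cfc_mul f g N, ← cfc_zero ℂ N]
    congr 1
    funext u
    change f u * g u = 0
    rw [mul_eq_zero]
    by_contra! hc
    have h1 : 0 < d / 2 - dist u z := by
      by_contra! h'
      exact hc.1 (by simp [f, max_eq_right h'])
    have h2 : 0 < d / 2 - dist u w := by
      by_contra! h'
      exact hc.2 (by simp [g, max_eq_right h'])
    have := dist_triangle_left w z u
    linarith
  · intro h0
    have := cfc_map_spectrum f N
    rw [h0, spectrum.zero_eq] at this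
    have h1 : f z ∈ f '' spectrum ℂ N := ⟨z, hz, rfl⟩
    rw [← this] at h1
    simp only [f, dist_self, Set.mem_singleton_iff, Complex.ofReal_eq_zero] at h1
    rw [max_eq_left (by linarith)] at h1
    linarith
  · intro h0
    have := cfc_map_spectrum g N
    rw [h0, spectrum.zero_eq] at this
    have h1 : g w ∈ g '' spectrum ℂ N := ⟨w, hw, rfl⟩
    rw [← this] at h1
    simp only [g, dist_self, Set.mem_singleton_iff, Complex.ofReal_eq_zero] at h1
    rw [max_eq_left (by linarith)] at h1
    linarith

/-- Schur's lemma for self-adjoint intertwiners. -/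
theorem IsIrreducibleRep.exists_eq_smul_one {π : A →⋆ₐ[ℂ] (H →L[ℂ] H)} (hπ : IsIrreducibleRep π)
    {N : H →L[ℂ] H} (hN : IsSelfAdjoint N) (hc : ∀ a, Commute N (π a)) :
    ∃ c : ℂ, N = algebraMap ℂ (H →L[ℂ] H) c := by
  by_contra! h
  obtain ⟨f, g, hfg, hf, hg⟩ := exists_mul_eq_zero_of_normal hN.isStarNormal h
  have hcomm : ∀ a, Commute (cfc f N) (π a) := fun a =>
    (hc a).cfc (by rw [hN.star_eq]; exact hc a) f
  -- The kernel of `f(N)` is invariant and contains the range of `g(N)`; either alternative makes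
  -- one of the two vanish.
  rcases hπ.2 (LinearMap.ker (cfc f N).toLinearMap) (cfc f N).isClosed_ker (fun T v hv => by
    have h1 := DFunLike.congr_fun (hcomm T).eq v
    have hv : cfc f N v = 0 := hv
    change cfc f N (π T v) = 0
    simpa [hv] using h1) with h1 | h1
  · apply hg
    ext v
    have : cfc g N v ∈ LinearMap.ker (cfc f N).toLinearMap := DFunLike.congr_fun hfg v
    rw [h1] at this
    simpa using this
  · apply hf
    ext v
    have : v ∈ LinearMap.ker (cfc f N).toLinearMap := h1 ▸ Submodule.mem_top
    exact this

/-- A state dominated by a multiple of a vector state of an irreducible representation is equal to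
it. -/
theorem IsIrreducibleRep.eq_of_le {π : A →⋆ₐ[ℂ] (H →L[ℂ] H)} (hπ : IsIrreducibleRep π) {x : H}
    (hx : ‖x‖ = 1) {φ : A →ₗ[ℂ] ℂ} (hφ : IsState φ) {C : ℝ}
    (hC : ∀ a, φ (star a * a) ≤ C * vectorState π x (star a * a)) : φ = vectorState π x := by
  obtain ⟨K, _, _, _, ρ, ξ, rfl⟩ := hφ.exists_eq_vectorState
  have hx0 : x ≠ 0 := by rintro rfl; simp at hx
  obtain ⟨W, hWx, hW⟩ := hπ.exists_intertwiner ρ hx0 ξ (C := Real.sqrt C) (fun a => by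
    have h := hC a
    rw [vectorState_star_mul_self, vectorState_star_mul_self] at h
    have h : ‖ρ a ξ‖ ^ 2 ≤ C * ‖π a x‖ ^ 2 := by exact_mod_cast h
    -- For `C ≤ 0` the default `Real.sqrt C = 0` still works, because domination then forces `ρ a ξ
    -- = 0`.
    rcases le_total 0 C with h0 | h0
    · refine abs_le_of_sq_le_sq' ?_ (by positivity) |>.2
      rw [mul_pow, Real.sq_sqrt h0]
      exact h
    · have : ‖ρ a ξ‖ ^ 2 ≤ 0 := h.trans (mul_nonpos_of_nonpos_of_nonneg h0 (sq_nonneg _))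
      have : ‖ρ a ξ‖ = 0 := by nlinarith [norm_nonneg (ρ a ξ)]
      rw [this]
      positivity)
  -- `W* W` is the Radon–Nikodym derivative of the dominated state; it commutes with `π`, so it is a
  -- scalar, and evaluation at `1` shows that this scalar is `1`.
  obtain ⟨c, hc⟩ := hπ.exists_eq_smul_one (N := W.adjoint ∘L W)
    (by
      rw [IsSelfAdjoint, ContinuousLinearMap.star_eq_adjoint, ContinuousLinearMap.adjoint_comp,
        ContinuousLinearMap.adjoint_adjoint])
    (fun a => by
      have h1 := congrArg ContinuousLinearMap.adjoint (hW (star a))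
      rw [ContinuousLinearMap.adjoint_comp, ContinuousLinearMap.adjoint_comp, map_star π, map_star ρ,
        ContinuousLinearMap.star_eq_adjoint, ContinuousLinearMap.star_eq_adjoint,
        ContinuousLinearMap.adjoint_adjoint, ContinuousLinearMap.adjoint_adjoint] at h1
      change (W.adjoint ∘L W) ∘L π a = π a ∘L (W.adjoint ∘L W)
      rw [ContinuousLinearMap.comp_assoc, hW, ← ContinuousLinearMap.comp_assoc, ← h1,
        ContinuousLinearMap.comp_assoc])
  have key : ∀ a, vectorState ρ ξ a = c * vectorState π x a := fun a => by
    have h1 : ρ a ξ = W (π a x) := by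
      rw [← hWx]; exact (DFunLike.congr_fun (hW a) x).symm
    have h2 : W.adjoint (W (π a x)) = c • π a x := by
      have := DFunLike.congr_fun hc (π a x)
      simpa [Algebra.algebraMap_eq_smul_one] using this
    rw [vectorState_apply, vectorState_apply, h1, ← hWx,
      ← ContinuousLinearMap.adjoint_inner_right, h2, inner_smul_right]
  have h1 := key 1
  rw [hφ.map_one, (isState_vectorState π hx).map_one, mul_one] at h1
  ext a
  rw [key, ← h1, one_mul]

/-- In a convex decomposition with weights `s, t > 0`, the first part is dominated by `s⁻¹` times
the vector state, hence equals it. -/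
theorem IsIrreducibleRep.isPureState {π : A →⋆ₐ[ℂ] (H →L[ℂ] H)} (hπ : IsIrreducibleRep π) {x : H}
    (hx : ‖x‖ = 1) : IsPureState (vectorState π x) := by
  refine ⟨isState_vectorState π hx, fun φ hφ ψ hψ h => ?_⟩
  obtain ⟨s, t, hs, ht, -, hst⟩ := h
  refine hπ.eq_of_le hx hφ (C := s⁻¹) fun a => ?_
  have h1 := DFunLike.congr_fun hst (star a * a)
  have h2 : (s : ℂ) * φ (star a * a) + t * ψ (star a * a) = vectorState π x (star a * a) := by
    simpa using h1
  rw [← h2, mul_add, ← mul_assoc, ← Complex.ofReal_mul, inv_mul_cancel₀ hs.ne', Complex.ofReal_one,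
    one_mul]
  refine le_add_of_nonneg_right (mul_nonneg ?_ (mul_nonneg ?_ (hψ.nonneg a)))
  · exact_mod_cast (inv_pos.mpr hs).le
  · exact_mod_cast ht.le

end General

/-- Induction on the elements of a universal C*-algebra. -/
theorem UnivCStar.induction_gen {X : Type} {R : Set (FreeStarAlg X)} {p : UnivCStar R → Prop}
    (hp : IsClosed {a | p a}) (one : p 1) (gen : ∀ x, p (UnivCStar.gen x))
    (star_gen : ∀ x, p (star (UnivCStar.gen x))) (mul : ∀ a b, p a → p b → p (a * b))
    (add : ∀ a b, p a → p b → p (a + b)) (smul : ∀ (c : ℂ) a, p a → p (c • a))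
    (T : UnivCStar R) : p T := by
  refine UnivCStar.ind hp (fun a => ?_) T
  change p (UnivCStar.coeHom R a)
  induction a using FreeStarAlg.induction' with
  | h1 => rwa [map_one]
  | hl l =>
    rcases l with ⟨x, _ | _⟩
    · exact gen x
    · have h1 := FreeStarAlg.star_letter (x, false)
      change star (FreeStarAlg.gen x) =
        MonoidAlgebra.single (FreeMonoid.of (x, true)) (1 : ℂ) at h1
      rw [← h1, map_star]
      exact star_gen x
  | hm a b ha hb => rw [map_mul]; exact mul _ _ ha hb
  | ha a b ha hb => rw [map_add]; exact add _ _ ha hb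
  | hs c a ha => rw [map_smul]; exact smul c _ ha

theorem StarAlgHom.continuous_of_cstar {A B : Type*} [CStarAlgebra A] [CStarAlgebra B]
    (π : A →⋆ₐ[ℂ] B) : Continuous π :=
  AddMonoidHomClass.continuous_of_bound π 1
    (fun a => by rw [one_mul]; exact NonUnitalStarAlgHom.norm_apply_le π a)

/-- A closed subspace invariant under the images of the generators and their adjoints is
invariant. -/
theorem UnivCStar.map_mem {X : Type} {R : Set (FreeStarAlg X)}
    {H : Type*} [NormedAddCommGroup H] [InnerProductSpace ℂ H] [CompleteSpace H]
    (π : UnivCStar R →⋆ₐ[ℂ] (H →L[ℂ] H)) {K : Submodule ℂ H} (hK : IsClosed (K : Set H))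
    (h : ∀ g, ∀ v ∈ K, π (UnivCStar.gen g) v ∈ K)
    (h' : ∀ g, ∀ v ∈ K, star (π (UnivCStar.gen g)) v ∈ K) (T : UnivCStar R) :
    ∀ v ∈ K, π T v ∈ K := by
  have hc := π.continuous_of_cstar
  refine UnivCStar.induction_gen (p := fun T => ∀ v ∈ K, π T v ∈ K) ?_ (by simp) h ?_ ?_ ?_ ?_ T
  · simp only [Set.ofPred_forall]
    refine isClosed_iInter fun v => isClosed_iInter fun _ => hK.preimage ?_
    fun_prop
  · simpa only [map_star] using h'
  · intro a b ha hb v hv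
    rw [map_mul]
    exact ha _ (hb v hv)
  · intro a b ha hb v hv
    rw [map_add]
    exact K.add_mem (ha v hv) (hb v hv)
  · intro c a ha v hv
    rw [map_smul]
    exact K.smul_mem c (ha v hv)

/-! ### Pure isometries and the vanishing of sandwiched operators. -/

section Pure

open Filter Topology

variable {H : Type*} [NormedAddCommGroup H] [InnerProductSpace ℂ H] [CompleteSpace H]

theorem star_apply_self_of_isometry {V : H →L[ℂ] H} (hV : star V * V = 1) (v : H) :
    star V (V v) = v := by
  have := DFunLike.congr_fun hV v
  simpa using this

theorem norm_apply_of_isometry {V : H →L[ℂ] H} (hV : star V * V = 1) (v : H) : ‖V v‖ = ‖v‖ := by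
  have h : inner ℂ (V v) (V v) = inner ℂ v v := by
    rw [← ContinuousLinearMap.adjoint_inner_right, ← ContinuousLinearMap.star_eq_adjoint,
      star_apply_self_of_isometry hV]
  rw [inner_self_eq_norm_sq_to_K, inner_self_eq_norm_sq_to_K] at h
  have h : ‖V v‖ ^ 2 = ‖v‖ ^ 2 := by exact_mod_cast h
  exact (sq_eq_sq₀ (norm_nonneg _) (norm_nonneg _)).mp h

theorem star_pow_mul_pow_of_isometry {V : H →L[ℂ] H} (hV : star V * V = 1) (n : ℕ) :
    star (V ^ n) * V ^ n = 1 := by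
  induction n with
  | zero => simp
  | succ n ih =>
    rw [pow_succ, star_mul, mul_assoc, ← mul_assoc (star (V ^ n)), ih, one_mul, hV]

/-- If `V` is a pure isometry then `V*ⁿ → 0` strongly. -/
theorem IsPureIsometry.tendsto_star_pow {V : H →L[ℂ] H} (hV : IsPureIsometry V) (v : H) :
    Tendsto (fun n => (star V ^ n) v) atTop (𝓝 0) := by
  obtain ⟨hV, hp⟩ := hV
  have hn := star_pow_mul_pow_of_isometry hV
  -- `p n` is the orthogonal projection of `v` onto the range of `V ^ n`.
  set p : ℕ → H := fun n => (V ^ n) ((star V ^ n) v) with hpdef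
  have hpn : ∀ n, ‖p n‖ = ‖(star V ^ n) v‖ := fun n => norm_apply_of_isometry (hn n) _
  have hanti : Antitone fun n => ‖p n‖ := by
    refine antitone_nat_of_succ_le fun n => ?_
    rw [hpn, hpn, pow_succ', mul_apply_eq_comp]
    refine ((star V).le_opNorm _).trans ?_
    have : ‖star V‖ ≤ 1 := by rw [norm_star]; exact norm_le_one_of_isometry hV
    nlinarith [norm_nonneg ((star V ^ n) v)]
  -- Pythagoras for nested ranges: convergence of the decreasing numbers `‖p n‖ ^ 2` will make `p`
  -- Cauchy.
  have hdiff : ∀ n k, ‖p n - p (n + k)‖ ^ 2 = ‖p n‖ ^ 2 - ‖p (n + k)‖ ^ 2 := fun n k => by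
    have hin : inner ℂ (p n) (p (n + k)) = ((‖p (n + k)‖ ^ 2 : ℝ) : ℂ) := by
      have h1 : p n = (V ^ n) (star (V ^ n) v) := by rw [star_pow]
      have h2 : p (n + k) = (V ^ n) ((V ^ k) ((star V ^ (n + k)) v)) := by
        rw [hpdef]; simp only [pow_add, mul_apply_eq_comp]
      rw [h1, ContinuousLinearMap.star_eq_adjoint, ← ContinuousLinearMap.adjoint_inner_right,
        ContinuousLinearMap.adjoint_inner_left, h2, ← ContinuousLinearMap.star_eq_adjoint,
        star_apply_self_of_isometry (hn n), ← h2, hpdef]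
      simp only
      rw [← ContinuousLinearMap.adjoint_inner_left, ← ContinuousLinearMap.star_eq_adjoint, star_pow,
        inner_self_eq_norm_sq_to_K, norm_apply_of_isometry (hn _)]
      simp
    rw [@norm_sub_sq ℂ, hin]
    simp only [RCLike.re_to_complex, Complex.ofReal_re]
    ring
  have hconv : ∃ l, Tendsto (fun n => ‖p n‖ ^ 2) atTop (𝓝 l) := by
    refine ⟨_, tendsto_atTop_ciInf (fun m n h => ?_) ⟨0, ?_⟩⟩
    · exact pow_le_pow_left₀ (norm_nonneg _) (hanti h) 2
    · rintro _ ⟨n, rfl⟩; positivity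
  obtain ⟨l, hl⟩ := hconv
  have hcauchy : CauchySeq p := by
    rw [Metric.cauchySeq_iff']
    intro ε hε
    obtain ⟨N, hN⟩ := Metric.cauchySeq_iff'.mp hl.cauchySeq (ε ^ 2) (by positivity)
    refine ⟨N, fun n hn' => ?_⟩
    obtain ⟨k, rfl⟩ := Nat.exists_eq_add_of_le hn'
    have h1 := hN _ hn'
    rw [Real.dist_eq, abs_sub_comm] at h1
    have h2 := (le_abs_self _).trans_lt h1
    rw [← hdiff] at h2
    rw [dist_comm, dist_eq_norm]
    exact lt_of_pow_lt_pow_left₀ 2 hε.le h2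
  obtain ⟨u, hu⟩ := cauchySeq_tendsto_of_complete hcauchy
  -- Each range is closed, being the fixed space of its projection, and contains `p m` for large
  -- `m`; so the limit lies in all of them.
  have hu0 : u = 0 := by
    have : u ∈ ⨅ n : ℕ, LinearMap.range ((V ^ (n + 1) : H →L[ℂ] H) : H →ₗ[ℂ] H) := by
      rw [Submodule.mem_iInf]
      intro n
      have h3 : IsClosed {w : H | (V ^ (n + 1)) (star (V ^ (n + 1)) w) = w} :=
        isClosed_eq (by fun_prop) (by fun_prop)
      have h4 : (V ^ (n + 1)) (star (V ^ (n + 1)) u) = u := by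
        refine h3.mem_of_tendsto hu ?_
        filter_upwards [eventually_ge_atTop (n + 1)] with m hm
        obtain ⟨k, rfl⟩ := Nat.exists_eq_add_of_le hm
        have h2 : p (n + 1 + k) = (V ^ (n + 1)) ((V ^ k) ((star V ^ (n + 1 + k)) v)) := by
          rw [hpdef]; simp only [pow_add, mul_apply_eq_comp]
        change (V ^ (n + 1)) (star (V ^ (n + 1)) (p (n + 1 + k))) = p (n + 1 + k)
        rw [h2, star_apply_self_of_isometry (hn _)]
      exact ⟨_, h4⟩
    rw [hp] at this
    simpa using this
  rw [hu0] at hu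
  rw [tendsto_zero_iff_norm_tendsto_zero] at hu ⊢
  simpa only [hpn] using hu

theorem sandwich_pow {H K : Type*} [NormedAddCommGroup H] [InnerProductSpace ℂ H]
    [NormedAddCommGroup K] [InnerProductSpace ℂ K]
    {D : H →L[ℂ] K} {S : K →L[ℂ] K} {T : H →L[ℂ] H}
    (h : D = S ∘L D ∘L T) (n : ℕ) (v : H) : D v = (S ^ n) (D ((T ^ n) v)) := by
  induction n with
  | zero => simp
  | succ n ih =>
    rw [ih, pow_succ S, pow_succ' T, mul_apply_eq_comp, mul_apply_eq_comp]
    congr 1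
    exact DFunLike.congr_fun h _

/-- An operator `D` with `D = S D V*` vanishes when `S` is an isometry and `V` a pure isometry. -/
theorem IsPureIsometry.eq_zero_of_sandwich {K : Type*} [NormedAddCommGroup K]
    [InnerProductSpace ℂ K] [CompleteSpace K] {D : H →L[ℂ] K} {S : K →L[ℂ] K} {V : H →L[ℂ] H}
    (hV : IsPureIsometry V) (hS : star S * S = 1) (h : D = S ∘L D ∘L star V) : D = 0 := by
  ext v
  have h1 : Tendsto (fun n => ‖D ((star V ^ n) v)‖) atTop (𝓝 0) := by
    have := ((D.continuous.tendsto 0).comp (hV.tendsto_star_pow v)).norm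
    simpa using this
  have h2 : ∀ n, ‖D ((star V ^ n) v)‖ = ‖D v‖ := fun n => by
    rw [sandwich_pow h n v, norm_apply_of_isometry (star_pow_mul_pow_of_isometry hS n)]
  simp only [h2] at h1
  exact norm_eq_zero.mp (tendsto_nhds_unique tendsto_const_nhds h1)

/-! ### The equation `u = a b* + b u a*` for a Cuntz pair `a`, `b`. -/

section Pair

variable {a b : H →L[ℂ] H}

/-- Compressing the range relation between `star a` and `b` gives `2 a*b = a*b`. -/
theorem star_mul_of_range_add (ha : star a * a = 1) (hb : star b * b = 1)
    (hab : a * star a + b * star b = 1) : star a * b = 0 := by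
  have h1 : star a * (a * star a + b * star b) * b = star a * b := by rw [hab, mul_one]
  have h2 : star a * (a * star a + b * star b) * b =
      (star a * a) * (star a * b) + (star a * b) * (star b * b) := by
    noncomm_ring
  rw [h2, ha, hb, one_mul, mul_one] at h1
  exact add_eq_left.mp h1

theorem norm_sq_add_of_pair (ha : star a * a = 1) (hb : star b * b = 1)
    (hab : a * star a + b * star b = 1) (v w : H) : ‖a v + b w‖ ^ 2 = ‖v‖ ^ 2 + ‖w‖ ^ 2 := by
  have h0 : inner ℂ (a v) (b w) = 0 := by
    rw [← ContinuousLinearMap.adjoint_inner_right, ← ContinuousLinearMap.star_eq_adjoint]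
    have := DFunLike.congr_fun (star_mul_of_range_add ha hb hab) w
    have : star a (b w) = 0 := this
    rw [this, inner_zero_right]
  rw [@norm_add_sq ℂ, h0, norm_apply_of_isometry ha, norm_apply_of_isometry hb]
  simp

theorem norm_sq_star_add_of_pair (hab : a * star a + b * star b = 1) (v : H)
    (ha : star a * a = 1) (hb : star b * b = 1) : ‖star a v‖ ^ 2 + ‖star b v‖ ^ 2 = ‖v‖ ^ 2 := by
  rw [← norm_sq_add_of_pair ha hb hab]
  have := DFunLike.congr_fun hab v
  have : a (star a v) + b (star b v) = v := this
  rw [this]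

/-- If `a` is pure, the equation `u = a b* + b u a*` has an isometric solution. -/
theorem exists_isometry_fixed (ha : IsPureIsometry a) (hb : star b * b = 1)
    (hab : a * star a + b * star b = 1) :
    ∃ u : H →L[ℂ] H, star u * u = 1 ∧ u = a * star b + b * u * star a := by
  have ha' := ha.1
  -- Iterates of `f ↦ a b* + b f a*` from `0`; all are contractions, because `a`, `b` have
  -- orthogonal ranges.
  let F : ℕ → (H →L[ℂ] H) := fun n => Nat.rec 0 (fun _ f => a * star b + b * f * star a) n
  have hF0 : F 0 = 0 := rfl
  have hFs : ∀ n, F (n + 1) = a * star b + b * F n * star a := fun n => rfl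
  have hFsv : ∀ n v, F (n + 1) v = a (star b v) + b (F n (star a v)) := fun n v => rfl
  have hle : ∀ n v, ‖F n v‖ ≤ ‖v‖ := by
    intro n
    induction n with
    | zero => intro v; simp [hF0]
    | succ n ih =>
      intro v
      refine (sq_le_sq₀ (norm_nonneg _) (norm_nonneg _)).mp ?_
      rw [hFsv, norm_sq_add_of_pair ha' hb hab, ← norm_sq_star_add_of_pair hab v ha' hb, add_comm]
      have := ih (star a v)
      gcongr
  -- The terms `a b*` cancel, so `F (n + k) - F n = bⁿ (F k) a*ⁿ`; purity of `a` makes this a Cauchy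
  -- estimate.
  have hd : ∀ n k v, ‖F (n + k) v - F n v‖ ≤ ‖(star a ^ n) v‖ := by
    intro n k
    induction n with
    | zero => intro v; simpa [hF0] using hle k v
    | succ n ih =>
      intro v
      have h1 : F (n + 1 + k) v - F (n + 1) v = b (F (n + k) (star a v) - F n (star a v)) := by
        rw [add_right_comm, hFsv, hFsv, map_sub]; abel
      rw [h1, norm_apply_of_isometry hb, pow_succ, mul_apply_eq_comp]
      exact ih _
  have hconv : ∀ v, ∃ w, Tendsto (fun n => F n v) atTop (𝓝 w) := fun v => by
    refine cauchySeq_tendsto_of_complete (Metric.cauchySeq_iff'.mpr fun ε hε => ?_)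
    obtain ⟨N, hN⟩ := Metric.tendsto_atTop.mp (ha.tendsto_star_pow v) ε hε
    refine ⟨N, fun n hn => ?_⟩
    obtain ⟨k, rfl⟩ := Nat.exists_eq_add_of_le hn
    rw [dist_eq_norm]
    refine (hd N k v).trans_lt ?_
    simpa using hN N le_rfl
  choose f hf using hconv
  let u : H →L[ℂ] H := continuousLinearMapOfTendsto F (tendsto_pi_nhds.mpr hf)
  have hu : ∀ v, Tendsto (fun n => F n v) atTop (𝓝 (u v)) := hf
  have heq : ∀ v, u v = a (star b v) + b (u (star a v)) := fun v => by
    refine tendsto_nhds_unique ((tendsto_add_atTop_iff_nat 1).mpr (hu v)) ?_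
    simp only [hFsv]
    exact tendsto_const_nhds.add ((b.continuous.tendsto _).comp (hu _))
  -- The summand `a b* v` has the norm of `b* v`, so the defect from isometry at `v` equals the one
  -- at `a* v`, and it tends to `0` along the powers.
  have hstep : ∀ n v, ‖u v‖ ^ 2 - ‖v‖ ^ 2 =
      ‖u ((star a ^ n) v)‖ ^ 2 - ‖(star a ^ n) v‖ ^ 2 := by
    intro n
    induction n with
    | zero => simp
    | succ n ih =>
      intro v
      rw [pow_succ (star a), mul_apply_eq_comp, ← ih, heq v, norm_sq_add_of_pair ha' hb hab,
        ← norm_sq_star_add_of_pair hab v ha' hb]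
      ring
  have hiso : ∀ v, ‖u v‖ = ‖v‖ := fun v => by
    have h0 := ha.tendsto_star_pow v
    have h1 := (((u.continuous.tendsto 0).comp h0).norm.pow 2).sub (h0.norm.pow 2)
    simp only [Function.comp_def, ← hstep] at h1
    have h2 := tendsto_nhds_unique tendsto_const_nhds h1
    simp only [map_zero, norm_zero, sub_self, sub_eq_zero] at h2
    exact (sq_eq_sq₀ (norm_nonneg _) (norm_nonneg _)).mp h2
  refine ⟨u, ?_, ContinuousLinearMap.ext heq⟩
  rw [ContinuousLinearMap.star_eq_adjoint]
  exact (ContinuousLinearMap.norm_map_iff_adjoint_comp_self u).mp hiso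

/-- If `a` and `b` are pure, there is a unitary `u` with `u b = a` and `u a = b u`. -/
theorem exists_unitary_of_pure (ha : IsPureIsometry a) (hb : IsPureIsometry b)
    (hab : a * star a + b * star b = 1) :
    ∃ u : H →L[ℂ] H, star u * u = 1 ∧ u * star u = 1 ∧ u * b = a ∧ u * a = b * u := by
  obtain ⟨u, hu, hue⟩ := exists_isometry_fixed ha hb.1 hab
  have hba : b * star b + a * star a = 1 := by rw [add_comm, hab]
  obtain ⟨w, hw, hwe⟩ := exists_isometry_fixed hb ha.1 hba
  -- Taking adjoints in the equation for `u` exchanges `a` and `b`, which is the equation solved by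
  -- `w`.
  have huw : star u - w = 0 := by
    refine hb.eq_zero_of_sandwich ha.1 ?_
    have : star u = b * star a + a * star u * star b := by
      conv_lhs => rw [hue]
      simp only [star_add, star_mul, star_star, mul_assoc]
    change star u - w = a * ((star u - w) * star b)
    conv_lhs => rw [this, hwe]
    noncomm_ring
  rw [sub_eq_zero] at huw
  have h1 := star_mul_of_range_add ha.1 hb.1 hab
  have h2 := star_mul_of_range_add hb.1 ha.1 hba
  refine ⟨u, hu, ?_, ?_, ?_⟩
  · rw [← huw, star_star] at hw
    exact hw
  · conv_lhs => rw [hue]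
    rw [add_mul, mul_assoc, hb.1, mul_assoc (b * u), h1, mul_one, mul_zero, add_zero]
  · conv_lhs => rw [hue]
    rw [add_mul, mul_assoc a, h2, mul_assoc (b * u), ha.1, mul_one, mul_zero, zero_add]

end Pair

/-! ### Passing from `O₂` to `Q₂`: extension of representations, intertwiners and states. -/

theorem map_isometry {B C : Type*} [CStarAlgebra B] [CStarAlgebra C] (π : B →⋆ₐ[ℂ] C) {s : B}
    (h : star s * s = 1) : star (π s) * π s = 1 := by
  rw [← map_star, ← map_mul, h, map_one]

theorem O2.map_range_S {B : Type*} [CStarAlgebra B] (π : O2 →⋆ₐ[ℂ] B) :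
    π (O2.S 0) * star (π (O2.S 0)) + π (O2.S 1) * star (π (O2.S 1)) = 1 := by
  rw [← map_star, ← map_star, ← map_mul, ← map_mul, ← map_add, O2.range_S, map_one]

theorem O2.incl_S_zero : O2.incl (O2.S 0) = Q2.U * Q2.S₂ := O2.lift_S _ _ _ 0

theorem O2.incl_S_one : O2.incl (O2.S 1) = Q2.S₂ := O2.lift_S _ _ _ 1

theorem Q2.U_mul_incl_S_zero : Q2.U * O2.incl (O2.S 0) = O2.incl (O2.S 1) * Q2.U := by
  rw [O2.incl_S_zero, O2.incl_S_one, Q2.S₂_mul_U, pow_two, mul_assoc]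

/-- A representation of `O₂` with pure generators extends to `Q₂`. -/
theorem exists_extension_of_pure (π : O2 →⋆ₐ[ℂ] (H →L[ℂ] H))
    (hp : ∀ i, IsPureIsometry (π (O2.S i))) :
    ∃ π' : Q2 →⋆ₐ[ℂ] (H →L[ℂ] H), ∀ a, π' (O2.incl a) = π a := by
  have hab := O2.map_range_S π
  obtain ⟨u, hu, hu', hub, hua⟩ := exists_unitary_of_pure (hp 0) (hp 1) hab
  set a := π (O2.S 0)
  set b := π (O2.S 1)
  -- The relation `b u = u² b` is `b u = u a` with `a = u b`.
  let π' := Q2.lift u b hu hu' (hp 1).1 (by rw [← hua, pow_two, mul_assoc, hub]) (by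
    rw [mul_assoc (u * b), ← star_mul, hub, add_comm, hab])
  refine ⟨π', fun T => ?_⟩
  have : π'.comp O2.incl = π := O2.hom_ext fun i => by
    fin_cases i
    · change π' (O2.incl (O2.S 0)) = a
      rw [O2.incl_S_zero, map_mul, Q2.lift_U, Q2.lift_S₂, hub]
    · change π' (O2.incl (O2.S 1)) = b
      rw [O2.incl_S_one, Q2.lift_S₂]
  exact DFunLike.congr_fun this T

/-- An operator intertwining the restrictions to `O₂` of two representations of `Q₂`, where the
first has pure generators, intertwines the representations of `Q₂`. -/
theorem intertwines_of_pure {K : Type*} [NormedAddCommGroup K] [InnerProductSpace ℂ K]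
    [CompleteSpace K] {π : Q2 →⋆ₐ[ℂ] (H →L[ℂ] H)} {ρ : Q2 →⋆ₐ[ℂ] (K →L[ℂ] K)}
    (hp : ∀ i, IsPureIsometry (π (O2.incl (O2.S i)))) {W : H →L[ℂ] K}
    (hW : ∀ a, W ∘L π (O2.incl a) = ρ (O2.incl a) ∘L W) (a : Q2) (v : H) :
    W (π a v) = ρ a (W v) := by
  set s := fun i => O2.incl (O2.S i) with hs
  have hWs : ∀ i v, W (π (s i) v) = ρ (s i) (W v) := fun i v => DFunLike.congr_fun (hW (O2.S i)) v
  have hWs' : ∀ i v, W (π (star (s i)) v) = ρ (star (s i)) (W v) := fun i v => by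
    have := DFunLike.congr_fun (hW (star (O2.S i))) v
    rw [map_star O2.incl] at this
    exact this
  have hiso : ∀ i, star (s i) * s i = 1 := fun i => map_isometry O2.incl (O2.isometry_S i)
  -- Multiply `1 = S₁S₁* + S₂S₂*` by `U` and use `US₁ = S₂U`, `US₂ = S₁`.
  have hU : Q2.U = s 0 * star (s 1) + s 1 * Q2.U * star (s 0) := by
    have h1 : Q2.U * (s 0 * star (s 0) + s 1 * star (s 1)) = Q2.U := by
      rw [O2.map_range_S O2.incl, mul_one]
    have h2 : Q2.U * s 0 = s 1 * Q2.U := Q2.U_mul_incl_S_zero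
    have h3 : Q2.U * s 1 = s 0 := by simp only [hs, O2.incl_S_zero, O2.incl_S_one]
    conv_lhs => rw [← h1, mul_add, ← mul_assoc, ← mul_assoc, h2, h3, add_comm]
  -- Substituting the recursion for `U` on both sides, the terms `S₁S₂*` cancel because `W`
  -- intertwines `O₂`.
  have hDU : ρ Q2.U ∘L W - W ∘L π Q2.U = 0 := by
    refine (hp 0).eq_zero_of_sandwich (S := ρ (s 1)) (map_isometry ρ (hiso 1)) ?_
    ext v
    have h1 : ∀ w, ρ Q2.U w = ρ (s 0) (ρ (star (s 1)) w) + ρ (s 1) (ρ Q2.U (ρ (star (s 0)) w)) :=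
      fun w => by
        conv_lhs => rw [hU]
        simp
    have h2 : ∀ w, π Q2.U w = π (s 0) (π (star (s 1)) w) + π (s 1) (π Q2.U (π (star (s 0)) w)) :=
      fun w => by
        conv_lhs => rw [hU]
        simp
    have h3 : star (π (s 0)) = π (star (s 0)) := (map_star π _).symm
    change ρ Q2.U (W v) - W (π Q2.U v) =
      ρ (s 1) (ρ Q2.U (W (star (π (s 0)) v)) - W (π Q2.U (star (π (s 0)) v)))
    rw [h3, h1 (W v), h2 v, map_add, map_sub, hWs, hWs, hWs', hWs']
    abel
  have hWU : ∀ v, W (π Q2.U v) = ρ Q2.U (W v) := fun v => by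
    have := DFunLike.congr_fun hDU v
    exact (sub_eq_zero.mp this).symm
  -- The adjoint of `U` is its inverse, so intertwining `U` suffices.
  have hWU' : ∀ v, W (π (star Q2.U) v) = ρ (star Q2.U) (W v) := fun v => by
    have h1 : ∀ w, ρ (star Q2.U) (ρ Q2.U w) = w := fun w => by
      rw [← mul_apply_eq_comp, ← map_mul, Q2.star_U_mul_U]; simp
    have h2 : π Q2.U (π (star Q2.U) v) = v := by
      rw [← mul_apply_eq_comp, ← map_mul, Q2.U_mul_star_U]; simp
    rw [← h1 (W (π (star Q2.U) v)), ← hWU, h2]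
  have hs1 : s 1 = Q2.S₂ := O2.incl_S_one
  have hc := π.continuous_of_cstar
  have hc' := ρ.continuous_of_cstar
  refine UnivCStar.induction_gen (p := fun a => ∀ v, W (π a v) = ρ a (W v)) ?_ (by simp) ?_ ?_ ?_ ?_
    ?_ a v
  · simp only [Set.ofPred_forall]
    exact isClosed_iInter fun v => isClosed_eq (by fun_prop) (by fun_prop)
  · rintro (_ | _)
    · exact hWU
    · have := hWs 1
      rwa [hs1] at this
  · rintro (_ | _)
    · exact hWU'
    · have := hWs' 1
      rwa [hs1] at this
  · intro a b ha hb v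
    rw [map_mul, map_mul, mul_apply_eq_comp, mul_apply_eq_comp, ha, hb]
  · intro a b ha hb v
    rw [map_add, map_add, add_apply, add_apply, map_add,
      ha, hb]
  · intro c a ha v
    rw [map_smul, map_smul, smul_apply, smul_apply,
      map_smul, ha]

/-- The only state extending `ω_x`, pure or not, is the vector state of the extended representation;
purity of the extension is then a consequence of uniqueness. -/
theorem hasUniquePureExtension_of_pure {π : O2 →⋆ₐ[ℂ] (H →L[ℂ] H)} (hπ : IsIrreducibleRep π)
    (hp : ∀ i, IsPureIsometry (π (O2.S i))) {x : H} (hx : ‖x‖ = 1) :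
    HasUniquePureExtension (vectorState π x) := by
  obtain ⟨π', hπ'⟩ := exists_extension_of_pure π hp
  have hx0 : x ≠ 0 := by rintro rfl; simp at hx
  have hpure := hπ.isPureState hx
  have huniq : ∀ Ω : Q2 →ₗ[ℂ] ℂ, IsState Ω → (∀ a, Ω (O2.incl a) = vectorState π x a) →
      Ω = vectorState π' x := by
    intro Ω hΩ hr
    obtain ⟨K, _, _, _, ρ, ξ, rfl⟩ := hΩ.exists_eq_vectorState
    obtain ⟨W, hWx, hW⟩ := hπ.exists_intertwiner (ρ.comp O2.incl) hx0 ξ (C := 1) (fun a => by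
      have h := hr (star a * a)
      rw [map_mul, map_star, vectorState_star_mul_self, vectorState_star_mul_self] at h
      have h : ‖ρ (O2.incl a) ξ‖ ^ 2 = ‖π a x‖ ^ 2 := by exact_mod_cast h
      rw [one_mul]
      exact ((sq_eq_sq₀ (norm_nonneg _) (norm_nonneg _)).mp h).le)
    have hW' : ∀ a v, W (π' a v) = ρ a (W v) := intertwines_of_pure
      (by simpa only [hπ'] using hp) (fun a => by rw [hπ']; exact hW a)
    have hWW : ∀ a, inner ℂ (W x) (W (π a x)) = inner ℂ x (π a x) := fun a => by
      have := hr a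
      rw [vectorState_apply, vectorState_apply] at this
      rw [← this, ← hπ', hW', hWx]
    have hd := hπ.denseRange hx0
    -- Density extends the identity from vectors `π a x` to all `v`; it is needed at `π' a x` with
    -- `a` in `Q₂`.
    have hWW' : ∀ v, inner ℂ (W x) (W v) = inner ℂ x v := fun v =>
      hd.induction_on (p := fun v => inner ℂ (W x) (W v) = inner ℂ x v) v
        (isClosed_eq (by fun_prop) (by fun_prop)) hWW
    ext a
    rw [vectorState_apply, vectorState_apply, ← hWW', hW', hWx]
  have hres : ∀ a, vectorState π' x (O2.incl a) = vectorState π x a := fun a => by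
    rw [vectorState_apply, vectorState_apply, hπ']
  refine ⟨hpure, vectorState π' x, ⟨⟨isState_vectorState π' hx, fun φ hφ ψ hψ h => ?_⟩,
    LinearMap.ext hres⟩, fun Ω hΩ => huniq Ω hΩ.1.1 fun a => DFunLike.congr_fun hΩ.2 a⟩
  have hrst : ∀ χ : Q2 →ₗ[ℂ] ℂ, IsState χ → IsState (χ ∘ₗ O2.incl.toAlgHom.toLinearMap) :=
    fun χ hχ =>
      { nonneg := fun a => by
          change 0 ≤ χ (O2.incl (star a * a))
          rw [map_mul, map_star]
          exact hχ.nonneg _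
        map_one := by
          change χ (O2.incl 1) = 1
          rw [map_one]
          exact hχ.map_one }
  obtain ⟨s, t, hs, ht, hst, hsum⟩ := h
  -- A decomposition of the extension restricts to one of the pure state `ω_x`, so `φ` also extends
  -- `ω_x`.
  have h1 := hpure.2 (hrst φ hφ) (hrst ψ hψ) ⟨s, t, hs, ht, hst, by
    ext a
    rw [← hres, ← hsum]
    rfl⟩
  exact huniq φ hφ fun a => DFunLike.congr_fun h1 a

end Pure

/-! ### Orthogonality and irreducibility for representations of `O₂`. -/

section Permutative

variable {H : Type*} [NormedAddCommGroup H] [InnerProductSpace ℂ H] [CompleteSpace H]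

theorem inner_star_apply (T : H →L[ℂ] H) (v w : H) : inner ℂ (star T v) w = inner ℂ v (T w) := by
  rw [ContinuousLinearMap.star_eq_adjoint, ContinuousLinearMap.adjoint_inner_left]

theorem inner_apply_star (T : H →L[ℂ] H) (v w : H) : inner ℂ v (star T w) = inner ℂ (T v) w := by
  rw [ContinuousLinearMap.star_eq_adjoint, ContinuousLinearMap.adjoint_inner_right]

theorem O2.star_map_S_apply_map_S (π : O2 →⋆ₐ[ℂ] (H →L[ℂ] H)) (j k : Fin 2) (v : H) :
    star (π (O2.S j)) (π (O2.S k) v) = if j = k then v else 0 := by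
  have hi := fun i => map_isometry π (O2.isometry_S i)
  have h01 := star_mul_of_range_add (hi 0) (hi 1) (O2.map_range_S π)
  have h10 := star_mul_of_range_add (hi 1) (hi 0) (by rw [add_comm]; exact O2.map_range_S π)
  have key : star (π (O2.S j)) * π (O2.S k) = if j = k then 1 else 0 := by
    fin_cases j <;> fin_cases k
    · exact hi 0
    · exact h01
    · exact h10
    · exact hi 1
  have := DFunLike.congr_fun key v
  rw [mul_apply_eq_comp] at this
  rw [this]
  split_ifs <;> simp

/-- In an irreducible representation of `O₂`, a set of vectors invariant up to zero under the
generators and their adjoints has no nonzero orthogonal vector unless it consists of zero. -/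
theorem IsIrreducibleRep.eq_zero_of_orthogonal {π : O2 →⋆ₐ[ℂ] (H →L[ℂ] H)}
    (hπ : IsIrreducibleRep π) {G : Set H} (h : ∀ j, ∀ w ∈ G, π (O2.S j) w = 0 ∨ π (O2.S j) w ∈ G)
    (h' : ∀ j, ∀ w ∈ G, star (π (O2.S j)) w = 0 ∨ star (π (O2.S j)) w ∈ G) {v : H}
    (hv : ∀ w ∈ G, inner ℂ w v = 0) : v = 0 ∨ ∀ w ∈ G, w = 0 := by
  have hmem : ∀ u, u ∈ (Submodule.span ℂ G)ᗮ ↔ ∀ w ∈ G, inner ℂ w u = 0 := fun u => by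
    rw [Submodule.mem_orthogonal]
    refine ⟨fun h w hw => h w (Submodule.subset_span hw), fun h w hw => ?_⟩
    induction hw using Submodule.span_induction with
    | mem w hw => exact h w hw
    | zero => exact inner_zero_left _
    | add a b _ _ ha hb => rw [inner_add_left, ha, hb, add_zero]
    | smul c a _ ha => rw [inner_smul_left, ha, mul_zero]
  -- Stability of `G` under generators and adjoints passes to its orthogonal complement.
  rcases hπ.2 (Submodule.span ℂ G)ᗮ (Submodule.isClosed_orthogonal _)
    (UnivCStar.map_mem π (Submodule.isClosed_orthogonal _)
      (fun j u hu => (hmem _).mpr fun w hw => by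
        change inner ℂ w (π (O2.S j) u) = 0
        rw [← inner_star_apply]
        rcases h' j w hw with h0 | h0
        · rw [h0, inner_zero_left]
        · exact (hmem u).mp hu _ h0)
      (fun j u hu => (hmem _).mpr fun w hw => by
        change inner ℂ w (star (π (O2.S j)) u) = 0
        rw [inner_apply_star]
        rcases h j w hw with h0 | h0
        · rw [h0, inner_zero_left]
        · exact (hmem u).mp hu _ h0)) with hK | hK
  · left
    have : v ∈ (Submodule.span ℂ G)ᗮ := (hmem v).mpr hv
    rw [hK] at this
    simpa using this
  · right
    intro w hw
    have : w ∈ (Submodule.span ℂ G)ᗮ := hK ▸ Submodule.mem_top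
    exact inner_self_eq_zero.mp ((hmem w).mp this w hw)

/-! ### The non-pure part of a generator and its dimension. -/

/-- The intersection of the ranges of the powers of an operator. -/
def coreRange (V : H →L[ℂ] H) : Submodule ℂ H :=
  ⨅ n : ℕ, LinearMap.range ((V ^ (n + 1) : H →L[ℂ] H) : H →ₗ[ℂ] H)

omit [CompleteSpace H] in
theorem mem_coreRange {V : H →L[ℂ] H} {v : H} :
    v ∈ coreRange V ↔ ∀ n : ℕ, ∃ w, (V ^ (n + 1)) w = v := by
  rw [coreRange, Submodule.mem_iInf]
  rfl

theorem isClosed_coreRange {V : H →L[ℂ] H} (hV : star V * V = 1) :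
    IsClosed (coreRange V : Set H) := by
  have : (coreRange V : Set H) = ⋂ n : ℕ, {v | (V ^ (n + 1)) (star (V ^ (n + 1)) v) = v} := by
    ext v
    rw [SetLike.mem_coe, mem_coreRange, Set.mem_iInter]
    refine forall_congr' fun n => ⟨?_, fun h => ⟨_, h⟩⟩
    rintro ⟨w, rfl⟩
    exact congrArg _ (star_apply_self_of_isometry (star_pow_mul_pow_of_isometry hV (n + 1)) w)
  rw [this]
  exact isClosed_iInter fun n => isClosed_eq (by fun_prop) (by fun_prop)

omit [CompleteSpace H] in
theorem apply_mem_coreRange {V : H →L[ℂ] H} {v : H} (hv : v ∈ coreRange V) :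
    V v ∈ coreRange V := by
  rw [mem_coreRange] at hv ⊢
  intro n
  obtain ⟨w, rfl⟩ := hv n
  exact ⟨V w, by rw [← mul_apply_eq_comp, ← mul_apply_eq_comp, ← pow_succ, pow_succ']⟩

theorem star_apply_mem_coreRange {V : H →L[ℂ] H} (hV : star V * V = 1) {v : H}
    (hv : v ∈ coreRange V) : star V v ∈ coreRange V := by
  rw [mem_coreRange] at hv ⊢
  intro n
  obtain ⟨w, rfl⟩ := hv (n + 1)
  refine ⟨w, ?_⟩
  rw [pow_succ' V (n + 1), mul_apply_eq_comp, star_apply_self_of_isometry hV]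

theorem apply_star_apply_of_mem_coreRange {V : H →L[ℂ] H} (hV : star V * V = 1) {v : H}
    (hv : v ∈ coreRange V) : V (star V v) = v := by
  obtain ⟨w, rfl⟩ := mem_coreRange.mp hv 0
  rw [zero_add, pow_one, star_apply_self_of_isometry hV]

/-- The core lies in the range of `S_i`, which is orthogonal to that of `S_j`. -/
theorem O2.star_map_S_apply_of_mem_coreRange (π : O2 →⋆ₐ[ℂ] (H →L[ℂ] H)) {i j : Fin 2}
    (hij : j ≠ i) {v : H} (hv : v ∈ coreRange (π (O2.S i))) : star (π (O2.S j)) v = 0 := by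
  rw [← apply_star_apply_of_mem_coreRange (map_isometry π (O2.isometry_S i)) hv,
    O2.star_map_S_apply_map_S, if_neg hij]

/-- A normal element which is not a scalar has two nonzero elements `F`, `G` commuting with its
adjoint such that `G* F = 0`. -/
theorem exists_star_mul_eq_zero_of_normal {A : Type*} [CStarAlgebra A] {N : A}
    (hN : IsStarNormal N) (h : ∀ c : ℂ, N ≠ algebraMap ℂ A c) :
    ∃ F G : A, star G * F = 0 ∧ F ≠ 0 ∧ G ≠ 0 ∧ Commute F (star N) ∧ Commute G (star N) := by
  obtain ⟨f, g, hfg, hf, hg⟩ := exists_mul_eq_zero_of_normal hN h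
  have hcomm : ∀ f : ℂ → ℂ, Commute (cfc f N) (star N) ∧ Commute (cfc f N) N := fun f =>
    ⟨hN.star_comm_self.symm.cfc (Commute.refl _) f, (Commute.refl N).cfc hN.star_comm_self f⟩
  refine ⟨cfc f N, star (cfc g N), ?_, hf, star_ne_zero.mpr hg, (hcomm f).1,
    (hcomm g).2.star_star⟩
  rw [star_star, ← hfg]
  exact cfc_commute_cfc g f N

/-- Words applied to `L` form a set stable, up to zero, under generators and adjoints: an adjoint
strips a letter, or acts on `L`, where `S_i*` preserves `L` and the other adjoint kills it. Moving
letters across the inner product onto `N` shows that this set is orthogonal to `N`. -/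
theorem IsIrreducibleRep.eq_zero_of_orthogonal_coreRange {π : O2 →⋆ₐ[ℂ] (H →L[ℂ] H)}
    (hπ : IsIrreducibleRep π) {i : Fin 2} {N L : Set H}
    (hN : ∀ v ∈ N, v ∈ coreRange (π (O2.S i)) ∧ star (π (O2.S i)) v ∈ N)
    (hL : ∀ v ∈ L, v ∈ coreRange (π (O2.S i)) ∧ star (π (O2.S i)) v ∈ L)
    (hNL : ∀ x ∈ N, ∀ y ∈ L, inner ℂ y x = 0) {x y : H} (hx : x ∈ N) (hy : y ∈ L) :
    x = 0 ∨ y = 0 := by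
  have hcons : ∀ j J (y : H), π (O2.word (j :: J)) y = π (O2.S j) (π (O2.word J) y) :=
    fun j J y => by simp [O2.word]
  have hnil : ∀ y : H, π (O2.word []) y = y := fun y => by simp [O2.word]
  have horth : ∀ J : List (Fin 2), ∀ x ∈ N, ∀ y ∈ L, inner ℂ (π (O2.word J) y) x = 0 := by
    intro J
    induction J with
    | nil => simpa only [hnil] using hNL
    | cons j J ih =>
      intro x hx y hy
      rw [hcons, ← inner_apply_star]
      by_cases hj : j = i
      · subst hj
        exact ih _ (hN x hx).2 y hy
      · rw [O2.star_map_S_apply_of_mem_coreRange π hj (hN x hx).1, inner_zero_right]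
  refine (hπ.eq_zero_of_orthogonal (G := {w | ∃ J, ∃ y ∈ L, π (O2.word J) y = w}) (v := x)
    ?_ ?_ ?_).imp_right fun h => h y ⟨[], y, hy, hnil y⟩
  · rintro j _ ⟨J, y, hy, rfl⟩
    exact Or.inr ⟨j :: J, y, hy, hcons _ _ _⟩
  · rintro j _ ⟨_ | ⟨k, J⟩, y, hy, rfl⟩
    · rw [hnil]
      by_cases hj : j = i
      · subst hj
        exact Or.inr ⟨[], _, (hL y hy).2, hnil _⟩
      · exact Or.inl (O2.star_map_S_apply_of_mem_coreRange π hj (hL y hy).1)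
    · rw [hcons, O2.star_map_S_apply_map_S]
      split_ifs
      · exact Or.inr ⟨J, y, hy, rfl⟩
      · exact Or.inl rfl
  · rintro _ ⟨J, y, hy, rfl⟩
    exact horth J x hx y hy

/-- In an irreducible representation of `O₂`, the intersection of the ranges of the powers of a
generator is at most one-dimensional. -/
theorem IsIrreducibleRep.coreRange_eq_zero_or {π : O2 →⋆ₐ[ℂ] (H →L[ℂ] H)}
    (hπ : IsIrreducibleRep π) {i : Fin 2} {x y : H} (hx : x ∈ coreRange (π (O2.S i)))
    (hy : y ∈ coreRange (π (O2.S i))) (hxy : inner ℂ y x = 0) : x = 0 ∨ y = 0 := by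
  set V := π (O2.S i) with hVdef
  have hV : star V * V = 1 := map_isometry π (O2.isometry_S i)
  set M := coreRange V
  have : CompleteSpace M := (isClosed_coreRange hV).completeSpace_coe
  let U : M →L[ℂ] M := (V ∘L M.subtypeL).codRestrict M fun v => apply_mem_coreRange v.2
  let U' : M →L[ℂ] M := (star V ∘L M.subtypeL).codRestrict M
    fun v => star_apply_mem_coreRange hV v.2
  have hU : ∀ v : M, ((U v : M) : H) = V v := fun v => rfl
  have hU' : ∀ v : M, ((U' v : M) : H) = star V v := fun v => rfl
  have hstar : star U = U' := by
    rw [ContinuousLinearMap.star_eq_adjoint, eq_comm, ContinuousLinearMap.eq_adjoint_iff]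
    intro v w
    rw [Submodule.coe_inner, Submodule.coe_inner, hU, hU', inner_star_apply]
  have hnorm : IsStarNormal U := ⟨by
    rw [hstar]
    ext v
    change star V (V v) = V (star V v)
    rw [star_apply_self_of_isometry hV, apply_star_apply_of_mem_coreRange hV v.2]⟩
  -- `V` is unitary on `M`. If it is scalar there, every line is `V*`-invariant, in particular those
  -- of `x` and `y`.
  by_cases hc : ∃ c : ℂ, U = algebraMap ℂ _ c
  · obtain ⟨c, hc⟩ := hc
    have hsm : ∀ v ∈ M, star V v = star c • v := fun v hv => by
      have h1 : star U = algebraMap ℂ _ (star c) := by rw [hc, algebraMap_star_comm]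
      rw [hstar, Algebra.algebraMap_eq_smul_one] at h1
      exact congrArg Subtype.val (DFunLike.congr_fun h1 ⟨v, hv⟩)
    have hinv : ∀ u ∈ M, ∀ v ∈ Submodule.span ℂ {u}, v ∈ M ∧ star V v ∈ Submodule.span ℂ {u} := by
      intro u hu v hv
      have hvM : v ∈ M := (Submodule.span_singleton_le_iff_mem u M).mpr hu hv
      exact ⟨hvM, by rw [hsm v hvM]; exact Submodule.smul_mem _ _ hv⟩
    refine hπ.eq_zero_of_orthogonal_coreRange (hinv x hx) (hinv y hy) ?_
      (Submodule.mem_span_singleton_self x) (Submodule.mem_span_singleton_self y)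
    intro v hv w hw
    obtain ⟨a, rfl⟩ := Submodule.mem_span_singleton.mp hv
    obtain ⟨b, rfl⟩ := Submodule.mem_span_singleton.mp hw
    rw [inner_smul_left, inner_smul_right, hxy, mul_zero, mul_zero]
  -- Otherwise the functional calculus gives nonzero orthogonal `V*`-invariant ranges in `M`,
  -- contradicting irreducibility.
  · push Not at hc
    obtain ⟨F, G, hGF, hF, hG, hFU, hGU⟩ :=
      exists_star_mul_eq_zero_of_normal (A := M →L[ℂ] M) hnorm hc
    rw [hstar] at hFU hGU
    have hrange : ∀ B : M →L[ℂ] M, Commute B U' →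
        ∀ v ∈ Set.range (fun u : M => ((B u : M) : H)), v ∈ M ∧
          star V v ∈ Set.range (fun u : M => ((B u : M) : H)) := by
      rintro B hB _ ⟨u, rfl⟩
      refine ⟨(B u).2, U' u, ?_⟩
      exact congrArg Subtype.val (DFunLike.congr_fun hB.eq u)
    have hne : ∀ B : M →L[ℂ] M, B ≠ 0 → ∃ a, B a ≠ 0 := by
      intro B hB
      by_contra! h
      exact hB (ContinuousLinearMap.ext h)
    have horth : ∀ v ∈ Set.range (fun u : M => ((F u : M) : H)),
        ∀ w ∈ Set.range (fun u : M => ((G u : M) : H)), inner ℂ w v = 0 := by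
      rintro _ ⟨u, rfl⟩ _ ⟨w, rfl⟩
      have h0 : star G (F u) = 0 := DFunLike.congr_fun hGF u
      have h1 := inner_apply_star G w (F u)
      rw [h0, inner_zero_right] at h1
      exact h1.symm
    obtain ⟨a, ha⟩ := hne F hF
    obtain ⟨b, hb⟩ := hne G hG
    rcases hπ.eq_zero_of_orthogonal_coreRange (hrange F hFU) (hrange G hGU) horth ⟨a, rfl⟩ ⟨b, rfl⟩
      with h | h
    · exact absurd (Subtype.ext h) ha
    · exact absurd (Subtype.ext h) hb

/-! ### Purity in permutative representations of type `P(I)`. -/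

namespace IsPermutative

variable {π : O2 →⋆ₐ[ℂ] (H →L[ℂ] H)} {e : HilbertBasis ℕ ℂ H} {σ : Fin 2 → ℕ → ℕ}

/-- The branching function system of a permutative representation has a coding map. -/
theorem exists_coding (h : IsPermutative π e σ) :
    ∃ (d : ℕ → Fin 2) (T : ℕ → ℕ), (∀ n, σ (d n) (T n) = n) ∧ (∀ j n, T (σ j n) = n) ∧
      ∀ j n, star (π (O2.S j)) (e n) = if j = d n then e (T n) else 0 := by
  have hex : ∀ n, ∃ (j : Fin 2) (k : ℕ), σ j k = n := fun n => by
    have : n ∈ Set.range (σ 0) ∪ Set.range (σ 1) := h.union ▸ Set.mem_univ n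
    rcases this with ⟨k, hk⟩ | ⟨k, hk⟩
    exacts [⟨0, k, hk⟩, ⟨1, k, hk⟩]
  -- `d n` is the branch containing `n` and `T n` its preimage there.
  choose d T hdT using hex
  have hdisj : ∀ j k m n, σ j m = σ k n → j = k := by
    intro j k m n hmn
    have h01 : ∀ m n, σ 0 m ≠ σ 1 n := fun m n hmn =>
      Set.disjoint_left.mp h.disjoint ⟨m, rfl⟩ ⟨n, hmn.symm⟩
    fin_cases j <;> fin_cases k
    · rfl
    · exact absurd hmn (h01 m n)
    · exact absurd hmn.symm (h01 n m)
    · rfl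
  refine ⟨d, T, hdT, fun j n => ?_, fun j n => ?_⟩
  · have h1 := hdT (σ j n)
    have h2 := hdisj _ _ _ _ h1
    rw [h2] at h1
    exact h.injective j h1
  · conv_lhs => rw [← hdT n, ← h.map_S, O2.star_map_S_apply_map_S]

/-- If a generator of an irreducible permutative representation is not pure, it fixes a basis
vector. -/
theorem exists_fixed_of_not_pure (hπ : IsIrreducibleRep π) (h : IsPermutative π e σ) {i : Fin 2}
    (hi : ¬ IsPureIsometry (π (O2.S i))) : ∃ m, σ i m = m := by
  obtain ⟨d, T, hdT, hT, hstar⟩ := h.exists_coding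
  set V := π (O2.S i) with hVdef
  have hV : star V * V = 1 := map_isometry π (O2.isometry_S i)
  have hne : coreRange V ≠ ⊥ := fun h0 => hi ⟨hV, h0⟩
  obtain ⟨v, hv, hv0⟩ := Submodule.exists_mem_ne_zero_of_ne_bot hne
  obtain ⟨m, hm⟩ : ∃ m, inner ℂ (e m) v ≠ 0 := by
    by_contra! h0
    apply hv0
    apply e.repr.injective
    ext m
    rw [e.repr_apply_apply, h0, map_zero]
    rfl
  -- Adjoints of generators send basis vectors to basis vectors or `0`, so a basis vector not killed
  -- by `V*ⁿ` lies in the range of `Vⁿ`.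
  have hpow : ∀ n m, star (V ^ n) (e m) ≠ 0 → ∃ k, (V ^ n) (e k) = e m := by
    intro n
    induction n with
    | zero => intro m _; exact ⟨m, by simp⟩
    | succ n ih =>
      intro m hm
      rw [pow_succ', star_mul, mul_apply_eq_comp, hstar] at hm
      split_ifs at hm with hd
      · obtain ⟨k, hk⟩ := ih _ hm
        refine ⟨k, ?_⟩
        rw [pow_succ', mul_apply_eq_comp, hk, hVdef, h.map_S]
        conv_lhs => rw [hd, hdT]
      · simp at hm
  have hmem : e m ∈ coreRange V := mem_coreRange.mpr fun n => by
    obtain ⟨w, rfl⟩ := mem_coreRange.mp hv n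
    obtain ⟨k, hk⟩ := hpow (n + 1) m fun h0 => hm (by
      rw [← inner_star_apply, h0, inner_zero_left])
    exact ⟨e k, hk⟩
  refine ⟨m, ?_⟩
  by_contra hσ
  have hmem' := apply_mem_coreRange hmem
  rw [hVdef, h.map_S] at hmem'
  rcases hπ.coreRange_eq_zero_or hmem hmem' (e.orthonormal.2 hσ) with h0 | h0
  exacts [e.orthonormal.ne_zero _ h0, e.orthonormal.ne_zero _ h0]

/-- A non-pure generator fixes some `e m`; the orbit of `k` under the coding map ends at `m`, which
is incompatible with orthonormality along `I`. -/
theorem isPureIsometry_of_isTypePVector (hπ : IsIrreducibleRep π) (h : IsPermutative π e σ)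
    {I : MultiIndex} (hI : 2 ≤ I.length) {k : ℕ} (hk : IsTypePVector π (e k) I) (i : Fin 2) :
    IsPureIsometry (π (O2.S i)) := by
  by_contra hi
  obtain ⟨m, hm⟩ := exists_fixed_of_not_pure hπ h hi
  obtain ⟨d, T, hdT, hT, hstar⟩ := h.exists_coding
  have hTm : T m = m := by
    conv_lhs => rw [← hm, hT]
  obtain ⟨a, ha⟩ : ∃ a, T^[a] k = m := by
    -- The basis vectors whose orbit avoids `m` would be stable under generators and adjoints,
    -- nonempty and orthogonal to `e m`.
    by_contra hka
    refine (hπ.eq_zero_of_orthogonal (G := e '' {n | ¬ ∃ a, T^[a] n = m}) (v := e m)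
      ?_ ?_ ?_).elim (e.orthonormal.ne_zero _)
      fun h0 => e.orthonormal.ne_zero _ (h0 _ ⟨k, hka, rfl⟩)
    · rintro j _ ⟨n, hn, rfl⟩
      rw [h.map_S]
      refine Or.inr ⟨_, ?_, rfl⟩
      rintro ⟨a, ha⟩
      -- The same `a` works: the extra application of `T` acts on its fixed point `m`.
      refine hn ⟨a, ?_⟩
      rw [← hT j n, ← Function.iterate_succ_apply, Function.iterate_succ_apply', ha, hTm]
    · rintro j _ ⟨n, hn, rfl⟩
      rw [hstar]
      split_ifs
      · refine Or.inr ⟨_, ?_, rfl⟩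
        rintro ⟨a, ha⟩
        exact hn ⟨a + 1, ha⟩
      · exact Or.inl rfl
    · rintro _ ⟨n, hn, rfl⟩
      refine e.orthonormal.2 ?_
      rintro rfl
      exact hn ⟨0, rfl⟩
  have hTam : ∀ a, T^[a] m = m := fun a => Function.iterate_fixed hTm a
  cases I with
  | finite w =>
    obtain ⟨hw, hon⟩ := hk
    have hword : ∀ (w : List (Fin 2)) n, ∃ n', π (O2.word w) (e n) = e n' ∧ T^[w.length] n' = n := by
      intro w n
      induction w with
      | nil => exact ⟨n, by simp [O2.word], rfl⟩
      | cons j w ih =>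
        obtain ⟨n', h1, h2⟩ := ih
        refine ⟨σ j n', ?_, ?_⟩
        · rw [← h.map_S, ← h1]
          simp [O2.word]
        · rw [List.length_cons, Function.iterate_succ_apply, hT, h2]
    have hinj : ∀ {p q}, e p = e q → p = q := fun {p q} hpq =>
      e.orthonormal.linearIndependent.injective hpq
    have hkk : T^[w.length] k = k := by
      obtain ⟨n', h1, h2⟩ := hword w k
      rw [hw] at h1
      rwa [← hinj h1] at h2
    have hlen : 2 ≤ w.length := by
      have : (2 : ℕ∞) ≤ (w.length : ℕ∞) := hI
      exact_mod_cast this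
    have hkm : k = m := by
      -- `w.length * a` is a period of `k` and at least `a`, so the orbit is by then stuck at `m`.
      have h1 : T^[w.length * a] k = k := by
        rw [Function.iterate_mul]
        exact Function.iterate_fixed hkk a
      have h2 : w.length * a = (w.length * a - a) + a :=
        (Nat.sub_add_cancel (Nat.le_mul_of_pos_left a (by omega))).symm
      rw [h2, Function.iterate_add_apply, ha, hTam] at h1
      exact h1.symm
    subst hkm
    match w, hlen, hw, hon with
    | j :: w', hlen, hw, hon =>
      obtain ⟨n', h1, h2⟩ := hword w' k
      have h3 : π (O2.word (j :: w')) (e k) = e (σ j n') := by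
        rw [← h.map_S, ← h1]
        simp [O2.word]
      rw [hw] at h3
      have h4 : k = σ j n' := hinj h3
      -- Stripping the first letter of `S_I v = v` applies `T` to the fixed index `k`, so the first
      -- letter alone fixes `v`.
      have h5 : n' = k := by rw [← hT j n', ← h4, hTm]
      rw [h5] at h4
      -- The vectors at positions `0` and `1` coincide; position `1` exists because `|I| ≥ 2`.
      have h6 := hon.2 (i := ⟨0, by omega⟩) (j := ⟨1, by omega⟩) (by simp)
      have h7 : π (O2.S j) (e k) = e k := by rw [h.map_S, ← h4]
      have h8 : e k = 0 := by simpa [O2.word, h7] using h6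
      exact e.orthonormal.ne_zero k h8
  | infinite w =>
    have hword : ∀ (w : List (Fin 2)) n, star (π (O2.word w)) (e n) ≠ 0 →
        star (π (O2.word w)) (e n) = e (T^[w.length] n) := by
      intro w
      induction w with
      | nil => intro n _; simp [O2.word]
      | cons j w ih =>
        intro n hn
        have h1 : star (π (O2.word (j :: w))) (e n) =
            star (π (O2.word w)) (star (π (O2.S j)) (e n)) := by
          simp [O2.word, star_mul]
        rw [h1, hstar] at hn ⊢
        split_ifs at hn ⊢
        · exact ih _ hn
        · simp at hn
    have hon : Orthonormal ℂ fun n : ℕ => π (star (O2.word (List.ofFn fun j : Fin n => w j))) (e k) :=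
      hk
    have hval : ∀ n, π (star (O2.word (List.ofFn fun j : Fin n => w j))) (e k) = e (T^[n] k) :=
      fun n => by
        have h1 := hon.ne_zero n
        rw [map_star] at h1 ⊢
        rw [hword _ _ h1, List.length_ofFn]
    -- From time `a` on the orbit stays at `m`, so two consecutive vectors are equal.
    have h1 := hon.2 (i := a) (j := a + 1) (by simp)
    simp only at h1
    rw [hval, hval, Function.iterate_succ_apply', ha, hTm] at h1
    exact e.orthonormal.ne_zero m (inner_self_eq_zero.mp h1)

end IsPermutative

end Permutative

end

theorem mainTheorem6 {H : Type*} [NormedAddCommGroup H] [InnerProductSpace ℂ H]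
    [CompleteSpace H] (π : O2 →⋆ₐ[ℂ] (H →L[ℂ] H)) (hπ : IsIrreducibleRep π) :
    ((∀ i, IsPureIsometry (π (O2.S i))) →
      ∀ x : H, ‖x‖ = 1 → HasUniquePureExtension (vectorState π x)) ∧
    (∀ I : MultiIndex, 2 ≤ I.length → IsTypeP π I →
      ∀ x : H, ‖x‖ = 1 → HasUniquePureExtension (vectorState π x)) := by
  refine ⟨fun hp x hx => hasUniquePureExtension_of_pure hπ hp hx, ?_⟩
  rintro I hI ⟨e, σ, k, hperm, -, hk⟩ x hx
  exact hasUniquePureExtension_of_pure hπ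
    (IsPermutative.isPureIsometry_of_isTypePVector hπ hperm hI hk) hx
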